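/- **Theorem 4.1.** Let $p\in\,]2,\infty[$ be a real number and $\alpha=\log 2/\log p$. Define $f_n:[0,1]\to[0,1]$ by $f_0=\mathrm{id}$ and inductively: on every maximal interval $I=[a,b]$ on which $f_n$ has positive derivative, cut $I$ into three consecutive pieces of lengths $\frac{|I|}{p},\frac{(p-2)|I|}{p},\frac{|I|}{p}$, let $f_{n+1}$ be equal to $\frac{f_n(a)+f_n(b)}{2}$ on the central piece and affine on each outer piece, with $f_{n+1}(a)=f_n(a)$, $f_{n+1}(b)=f_n(b)$ and $f_{n+1}$ continuous; elsewhere $f_{n+1}=f_n$. Let $f=\lim_n f_n$ be the resulting Cantor–Lebesgue function, put $\gamma(t)=\int_0^t e^{i\pi f(s)}\,ds\in\mathbb{C}=\mathbb{R}^2$ for $t\in[0,1]$, and let $\Gamma_p$ be the union of $\gamma([0,1])$ and its image under the rotation by $\pi$ around $(\gamma(0)+\gamma(1))/2$. Then $\Gamma_p$ is the boundary of a nonempty bounded open convex set $\Omega_p$, namely the interior of the convex hull of $\Gamma_p$ (the *Cantor–Lebesgue domain*). Equip $\Omega_p$ with the Hilbert distance $$d(x,y)=\frac12\left|\log\frac{|y-a|\,|x-b|}{|x-a|\,|y-b|}\right|\quad(x\ne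 y),\qquad d(x,x)=0,$$ where $a,b\in\partial\Omega_p$ are the points such that $a,x,y,b$ are aligned in this order. For $x\in\Omega_p$ and $v\neq 0$ let $\|v\|_x=\frac12\left(\frac1{t_1}+\frac1{t_2}\right)$, where $t_1,t_2>0$ and $x+t_1v,\ x-t_2v\in\partial\Omega_p$, and let $\|0\|_x=0$. Let $\mu$ be the measure on $\Omega_p$ with density $\sigma(x)=\pi/\mathcal L(\{v:\|v\|_x<1\})$ with respect to the Lebesgue measure $\mathcal L$. Write $B(x,R)$ for the open $d$-ball of centre $x$ and radius $R$. Then the volume entropy of this geometry exists and equals $2\alpha/(1+\alpha)$: for every $x\in\Omega_p$, $$\lim_{R\to\infty}\frac{\log\mu(B(x,R))}{R}=\frac{2\alpha}{1+\alpha}.$$ -/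

import Mathlib

open Set Filter Topology MeasureTheory

noncomputable section

namespace HilbertGeometry

/-- The parameter `t` with `0 < t` and `x + t v ∈ ∂Ω`. It is unique when `Ω` is open, bounded and
convex, `x ∈ Ω` and `v ≠ 0`; for `v = 0` there is none and the value is `0`. -/
def exitTime (Ω : Set ℂ) (x v : ℂ) : ℝ :=
  sInf {t : ℝ | 0 < t ∧ x + t • v ∈ frontier Ω}

/-- The point of `∂Ω` on the ray from `x` in the direction `v` (it is `x` itself if `v = 0`). -/
def exitPoint (Ω : Set ℂ) (x v : ℂ) : ℂ :=
  x + exitTime Ω x v • v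

/-- The Hilbert distance `½ |log (|y - a| |x - b| / (|x - a| |y - b|))|`, where `a, b ∈ ∂Ω` are
such that `a, x, y, b` are aligned in this order. (For `x = y` this is `½ |log 0| = 0`.) -/
def hilbertDist (Ω : Set ℂ) (x y : ℂ) : ℝ :=
  let a := exitPoint Ω x (x - y)
  let b := exitPoint Ω y (y - x)
  1 / 2 * |Real.log ((‖y - a‖ * ‖x - b‖) / (‖x - a‖ * ‖y - b‖))|

/-- The open ball of the Hilbert distance. -/
def hilbertBall (Ω : Set ℂ) (x : ℂ) (R : ℝ) : Set ℂ :=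
  {y | y ∈ Ω ∧ hilbertDist Ω x y < R}

/-- The Finsler norm `‖v‖_x = ½ (1 / t₁ + 1 / t₂)`, where `t₁, t₂ > 0` are such that
`x + t₁ v` and `x - t₂ v` lie on `∂Ω`. -/
def finslerNorm (Ω : Set ℂ) (x v : ℂ) : ℝ :=
  1 / 2 * (1 / exitTime Ω x v + 1 / exitTime Ω x (-v))

/-- The Busemann function: the area of the Euclidean unit disc divided by the area of the unit
disc of the Finsler norm at `x`. -/
def busemann (Ω : Set ℂ) (x : ℂ) : ENNReal :=
  volume (Metric.ball (0 : ℂ) 1) / volume {v : ℂ | finslerNorm Ω x v < 1}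

/-- The Hausdorff measure of the Hilbert geometry: the measure on `Ω` whose density with respect
to the Lebesgue measure is the Busemann function. -/
def hilbertMeasure (Ω : Set ℂ) : Measure ℂ :=
  (volume.restrict Ω).withDensity (busemann Ω)

/-- `log (μ (B (x, R))) / R` converges to `h` as `R → ∞`, for every base point `x ∈ Ω`. -/
def HasVolumeEntropy (Ω : Set ℂ) (h : ℝ) : Prop :=
  ∀ x ∈ Ω, Tendsto (fun R : ℝ => Real.log (hilbertMeasure Ω (hilbertBall Ω x R)).toReal / R)
    atTop (𝓝 h)

end HilbertGeometry

namespace CantorLebesgue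

/-- The result of `n` steps of the Cantor-Lebesgue construction with ratio `1 / p`, started from
the affine function on `[a, b]` with value `c` at `a` and `d` at `b`. One step cuts every interval
`I` on which the function is still affine and increasing into three pieces of lengths `|I| / p`,
`(p - 2) |I| / p` and `|I| / p`, replaces the function on the central piece by the mean of its
values at the ends of `I`, and interpolates affinely on the two outer pieces. Performing `n + 1`
steps on `[a, b]` thus means cutting `[a, b]` once and performing `n` steps on both outer pieces. -/
def refine (p : ℝ) : ℕ → ℝ → ℝ → ℝ → ℝ → ℝ → ℝ
  | 0, a, b, c, d, x => c + (d - c) * ((x - a) / (b - a))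
  | n + 1, a, b, c, d, x =>
      if x ≤ a + (b - a) / p then
        refine p n a (a + (b - a) / p) c ((c + d) / 2) x
      else if x < b - (b - a) / p then
        (c + d) / 2
      else
        refine p n (b - (b - a) / p) b ((c + d) / 2) d x

/-- The `n`-th approximation `f_n : [0, 1] → [0, 1]`; in particular `f_0` is the identity. -/
def approx (p : ℝ) (n : ℕ) (x : ℝ) : ℝ :=
  refine p n 0 1 0 1 x

/-- The Cantor-Lebesgue function `f = lim f_n` (on `[0, 1]`). -/
def cantorLebesgue (p x : ℝ) : ℝ :=
  limUnder atTop (fun n => approx p n x)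

theorem refine_mem (p : ℝ) (hp : 2 < p) (n : ℕ) : ∀ a b c d x : ℝ, a < b → c ≤ d → a ≤ x → x ≤ b →
    c ≤ refine p n a b c d x ∧ refine p n a b c d x ≤ d := by
  induction n with
  | zero =>
    intro a b c d x hab hcd hax hxb
    have h0 : 0 ≤ (x - a) / (b - a) := div_nonneg (by linarith) (by linarith)
    have h1 : (x - a) / (b - a) ≤ 1 := (div_le_one (by linarith)).2 (by linarith)
    constructor <;> simp only [refine] <;> nlinarith
  | succ n ih =>
    intro a b c d x hab hcd hax hxb
    have hl : 0 < (b - a) / p := div_pos (by linarith) (by linarith)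
    simp only [refine]
    split_ifs with h1 h2
    · have := ih a (a + (b - a) / p) c ((c + d) / 2) x (by linarith) (by linarith) hax h1
      constructor <;> linarith
    · constructor <;> linarith
    · have := ih (b - (b - a) / p) b ((c + d) / 2) d x (by linarith) (by linarith)
        (by linarith) hxb
      constructor <;> linarith

theorem abs_refine_sub_le (p : ℝ) (hp : 2 < p) (n : ℕ) : ∀ a b c d x : ℝ, a < b → c ≤ d →
    a ≤ x → x ≤ b →
    |refine p n a b c d x - refine p (n + 1) a b c d x| ≤ (d - c) * (1 / 2) ^ n := by
  induction n with
  | zero =>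
    intro a b c d x hab hcd hax hxb
    have h0 := refine_mem p hp 0 a b c d x hab hcd hax hxb
    have h1 := refine_mem p hp (0 + 1) a b c d x hab hcd hax hxb
    rw [abs_le]
    constructor <;> simp only [pow_zero, mul_one] <;> linarith
  | succ n ih =>
    intro a b c d x hab hcd hax hxb
    have hl : 0 < (b - a) / p := div_pos (by linarith) (by linarith)
    have hh : (d - c) * (1 / 2) ^ (n + 1) = ((d - c) / 2) * (1 / 2 : ℝ) ^ n := by ring
    have hpos : 0 ≤ ((d - c) / 2) * (1 / 2 : ℝ) ^ n := mul_nonneg (by linarith) (by positivity)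
    rw [hh, refine.eq_2 p a b c d x n, refine.eq_2 p a b c d x (n + 1)]
    split_ifs with h1 h2
    · have := ih a (a + (b - a) / p) c ((c + d) / 2) x (by linarith) (by linarith) hax h1
      rwa [show (c + d) / 2 - c = (d - c) / 2 by ring] at this
    · simpa using hpos
    · have := ih (b - (b - a) / p) b ((c + d) / 2) d x (by linarith) (by linarith)
        (by linarith) hxb
      rwa [show d - (c + d) / 2 = (d - c) / 2 by ring] at this

/-- The limit that defines the Cantor-Lebesgue function exists. -/
theorem tendsto_approx (p : ℝ) (hp : 2 < p) (x : ℝ) (hx : x ∈ Icc (0 : ℝ) 1) :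
    Tendsto (fun n => approx p n x) atTop (𝓝 (cantorLebesgue p x)) := by
  have hc : CauchySeq (fun n => approx p n x) := by
    refine cauchySeq_of_le_geometric (1 / 2) 1 (by norm_num) fun n => ?_
    have := abs_refine_sub_le p hp n 0 1 0 1 x (by norm_num) (by norm_num) hx.1 hx.2
    simpa [Real.dist_eq, approx] using this
  exact hc.tendsto_limUnder

/-- The curve `γ(t) = ∫₀ᵗ e^{iπ f(s)} ds`. -/
def curve (p t : ℝ) : ℂ :=
  ∫ s in (0 : ℝ)..t, Complex.exp (Complex.I * (Real.pi * cantorLebesgue p s : ℝ))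

/-- The closed curve made of `γ([0, 1])` and of its image under the rotation by `π` around
`(γ(0) + γ(1)) / 2`. -/
def boundaryCurve (p : ℝ) : Set ℂ :=
  curve p '' Icc 0 1 ∪ (fun z => curve p 0 + curve p 1 - z) '' (curve p '' Icc 0 1)

/-- The Cantor-Lebesgue domain: the open convex set spanned by the closed curve. -/
def domain (p : ℝ) : Set ℂ :=
  interior (convexHull ℝ (boundaryCurve p))

end CantorLebesgue

end

/-!
The tangent direction of the curve `γ` at time `s` has angle `π f(s)`, which increases from `0`
to `π`. Hence the cross product of two successive chords, which is a double integral of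
`sin (π (f v - f u))`, is nonnegative, and every tangent line supports the closed curve
(`cross_tangent_nonneg`). Every ray from the centre meets the closed curve by the intermediate
value theorem, so the closed curve is the whole boundary of its convex hull (`frontier_domain`).

For the entropy, everything is expressed with the Minkowski gauges `G_x` of the domain `Ω` seen from
its points: the Finsler norm at `x` is `(G_x(v) + G_x(-v)) / 2`, and the Hilbert distance is
`½ log ((1 + G_x(x - y)) (1 + G_y(y - x)))`. So, up to constants, the ball of radius `R` consists of
the points that stay in `Ω` when pushed away from the centre by the factor `1 + e^{-2R}`, and the
density at `y` is the inverse of the area of `Ω ∩ (2y - Ω)`.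

At stage `n` of the construction there are `2 ^ n` increasing intervals, of length `h = p ⁻ⁿ`, over
which the curve turns by `θ = π 2 ⁻ⁿ`. They cut off caps of width `h` and height about
`h θ ≈ (2p)⁻ⁿ`. Let `n` be such that `(2p)⁻ⁿ ≈ e^{-2R}`; then the ball has measure about `2 ^ n`:

* From below (`exists_le_hilbertMeasure`): the caps are disjoint, a definite part of each of them is
  in the ball, and for `y` in a cap the set `Ω ∩ (2y - Ω)` is covered by the cap and its reflection,
  so that each cap contributes a definite amount.
* From above (`exists_hilbertMeasure_shrunkDomain_le`): the ball is covered by the sectors, seen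
  from the centre, over the `2 ^ n` increasing intervals and the `2 ^ n - 1` flat ones between them,
  and over their reflections. If `u` and `v` are the position vectors of the ends of such an
  interval, then `Ω` contains the rhombus with vertices `± u`, `± v`. Comparing the density with
  that of the rhombus bounds the measure of the part of the ball in the sector by a multiple of `R ^ 2`.

Therefore `log μ(B(x, R)) = n log 2 + O(log R)` with `n = 2R / log (2p) + O(1)`, and the entropy is
`2 log 2 / log (2p) = 2α / (1 + α)`.
-/

noncomputable section

/-! ### Hilbert geometry of a bounded open convex set in terms of Minkowski gauges -/

namespace HilbertGeometry

/-- The Minkowski gauge of `Ω` seen from `x`: the inverse of the time at which the ray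
`t ↦ x + t v` leaves `Ω`. -/
def gaugeAt (Ω : Set ℂ) (x v : ℂ) : ℝ :=
  gauge ((x + ·) ⁻¹' Ω) v

variable {Ω : Set ℂ} {x y v : ℂ}

theorem gaugeAt_nonneg : 0 ≤ gaugeAt Ω x v := gauge_nonneg _

theorem isOpen_translate (ho : IsOpen Ω) : IsOpen ((x + ·) ⁻¹' Ω) :=
  ho.preimage (by fun_prop)

theorem convex_translate (hc : Convex ℝ Ω) : Convex ℝ ((x + ·) ⁻¹' Ω) :=
  hc.translate_preimage_right x

theorem translate_mem_nhds (ho : IsOpen Ω) (hx : x ∈ Ω) : (x + ·) ⁻¹' Ω ∈ 𝓝 (0 : ℂ) :=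
  (isOpen_translate ho).mem_nhds (by simpa using hx)

theorem gaugeAt_lt_one_iff (ho : IsOpen Ω) (hc : Convex ℝ Ω) (hx : x ∈ Ω) :
    gaugeAt Ω x v < 1 ↔ x + v ∈ Ω := by
  rw [gaugeAt, gauge_lt_one_iff_mem_interior (convex_translate hc) (translate_mem_nhds ho hx),
    (isOpen_translate ho).interior_eq]
  rfl

theorem gaugeAt_smul {t : ℝ} (ht : 0 ≤ t) : gaugeAt Ω x (t • v) = t * gaugeAt Ω x v := by
  rw [gaugeAt, gauge_smul_of_nonneg ht, smul_eq_mul, gaugeAt]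

theorem gaugeAt_add_le (ho : IsOpen Ω) (hc : Convex ℝ Ω) (hx : x ∈ Ω) (u v : ℂ) :
    gaugeAt Ω x (u + v) ≤ gaugeAt Ω x u + gaugeAt Ω x v :=
  gauge_add_le (convex_translate hc) (absorbent_nhds_zero (translate_mem_nhds ho hx)) _ _

theorem gaugeAt_eq_one_iff (ho : IsOpen Ω) (hc : Convex ℝ Ω) (hx : x ∈ Ω) :
    gaugeAt Ω x v = 1 ↔ x + v ∈ frontier Ω := by
  rw [gaugeAt, gauge_eq_one_iff_mem_frontier (convex_translate hc) (translate_mem_nhds ho hx)]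
  have := (Homeomorph.addLeft x).preimage_frontier Ω
  rw [show ((x + ·) ⁻¹' Ω) = (Homeomorph.addLeft x) ⁻¹' Ω from rfl, ← this]
  rfl

theorem gaugeAt_pos (ho : IsOpen Ω) (hb : Bornology.IsBounded Ω) (hx : x ∈ Ω) (hv : v ≠ 0) :
    0 < gaugeAt Ω x v := by
  refine (gauge_pos (absorbent_nhds_zero (translate_mem_nhds ho hx)) ?_).2 hv
  rw [NormedSpace.isVonNBounded_iff]
  obtain ⟨r, hr⟩ := hb.subset_closedBall x
  refine (Metric.isBounded_closedBall (x := (0 : ℂ)) (r := r)).subset fun u hu => ?_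
  have := hr hu
  simpa [dist_eq_norm] using this

/-- For `v = 0` both sides vanish: the infimum is that of the empty set, and `0⁻¹ = 0`. -/
theorem exitTime_eq (ho : IsOpen Ω) (hc : Convex ℝ Ω) (hb : Bornology.IsBounded Ω) (hx : x ∈ Ω) :
    exitTime Ω x v = (gaugeAt Ω x v)⁻¹ := by
  have key : {t : ℝ | 0 < t ∧ x + t • v ∈ frontier Ω} =
      {t : ℝ | 0 < t ∧ t * gaugeAt Ω x v = 1} := by
    ext t
    refine and_congr_right fun ht => ?_
    rw [← gaugeAt_smul ht.le, gaugeAt_eq_one_iff ho hc hx]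
  rw [exitTime, key]
  rcases eq_or_ne v 0 with rfl | hv
  · simp [gaugeAt]
  · have h0 := gaugeAt_pos ho hb hx hv
    have : {t : ℝ | 0 < t ∧ t * gaugeAt Ω x v = 1} = {(gaugeAt Ω x v)⁻¹} := by
      ext t
      simp only [mem_ofPred_eq, mem_singleton_iff]
      constructor
      · rintro ⟨-, h⟩
        exact eq_inv_of_mul_eq_one_left h
      · rintro rfl
        exact ⟨inv_pos.2 h0, inv_mul_cancel₀ h0.ne'⟩
    rw [this, csInf_singleton]

theorem finslerNorm_eq (ho : IsOpen Ω) (hc : Convex ℝ Ω) (hb : Bornology.IsBounded Ω)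
    (hx : x ∈ Ω) : finslerNorm Ω x v = 1 / 2 * (gaugeAt Ω x v + gaugeAt Ω x (-v)) := by
  simp [finslerNorm, exitTime_eq ho hc hb hx]

theorem hilbertDist_eq (ho : IsOpen Ω) (hc : Convex ℝ Ω) (hb : Bornology.IsBounded Ω)
    (hx : x ∈ Ω) (hy : y ∈ Ω) :
    hilbertDist Ω x y =
      1 / 2 * Real.log ((1 + gaugeAt Ω x (x - y)) * (1 + gaugeAt Ω y (y - x))) := by
  rcases eq_or_ne x y with rfl | hxy
  · simp [hilbertDist, exitPoint, gaugeAt]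
  · have hs := gaugeAt_pos ho hb hx (sub_ne_zero.2 hxy)
    have ht := gaugeAt_pos ho hb hy (sub_ne_zero.2 hxy.symm)
    set s := gaugeAt Ω x (x - y)
    set t := gaugeAt Ω y (y - x)
    have hn : 0 < ‖y - x‖ := norm_pos_iff.2 (sub_ne_zero.2 hxy.symm)
    have e1 : ‖y - exitPoint Ω x (x - y)‖ = (1 + s⁻¹) * ‖y - x‖ := by
      rw [exitPoint, exitTime_eq ho hc hb hx,
        show y - (x + s⁻¹ • (x - y)) = (1 + s⁻¹) • (y - x) by module, norm_smul,
        Real.norm_of_nonneg (by positivity)]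
    have e2 : ‖x - exitPoint Ω x (x - y)‖ = s⁻¹ * ‖y - x‖ := by
      rw [exitPoint, exitTime_eq ho hc hb hx,
        show x - (x + s⁻¹ • (x - y)) = s⁻¹ • (y - x) by module, norm_smul,
        Real.norm_of_nonneg (by positivity)]
    have e3 : ‖x - exitPoint Ω y (y - x)‖ = (1 + t⁻¹) * ‖y - x‖ := by
      rw [exitPoint, exitTime_eq ho hc hb hy,
        show x - (y + t⁻¹ • (y - x)) = (-(1 + t⁻¹)) • (y - x) by module, norm_smul,
        norm_neg, Real.norm_of_nonneg (by positivity)]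
    have e4 : ‖y - exitPoint Ω y (y - x)‖ = t⁻¹ * ‖y - x‖ := by
      rw [exitPoint, exitTime_eq ho hc hb hy,
        show y - (y + t⁻¹ • (y - x)) = (-t⁻¹) • (y - x) by module, norm_smul,
        norm_neg, Real.norm_of_nonneg (by positivity)]
    simp only [hilbertDist, e1, e2, e3, e4]
    have : (1 + s⁻¹) * ‖y - x‖ * ((1 + t⁻¹) * ‖y - x‖) / (s⁻¹ * ‖y - x‖ * (t⁻¹ * ‖y - x‖)) =
        (1 + s) * (1 + t) := by field_simp; ring
    rw [this, abs_of_nonneg (Real.log_nonneg (by nlinarith [mul_pos hs ht]))]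

theorem hilbertBall_subset (ho : IsOpen Ω) (hc : Convex ℝ Ω) (hb : Bornology.IsBounded Ω)
    (hx : x ∈ Ω) (R : ℝ) :
    hilbertBall Ω x R ⊆ {y | y ∈ Ω ∧ y + Real.exp (-(2 * R)) • (y - x) ∈ Ω} := by
  rintro y ⟨hy, hR⟩
  refine ⟨hy, ?_⟩
  rw [hilbertDist_eq ho hc hb hx hy] at hR
  have hs : 0 ≤ gaugeAt Ω x (x - y) := gaugeAt_nonneg
  have ht : 0 ≤ gaugeAt Ω y (y - x) := gaugeAt_nonneg
  rw [← gaugeAt_lt_one_iff ho hc hy, gaugeAt_smul (Real.exp_nonneg _), Real.exp_neg,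
    inv_mul_lt_iff₀ (Real.exp_pos _), mul_one]
  have hlog : Real.log ((1 + gaugeAt Ω x (x - y)) * (1 + gaugeAt Ω y (y - x))) < 2 * R := by
    linarith
  have := (Real.log_lt_iff_lt_exp (by positivity)).1 hlog
  nlinarith [mul_nonneg hs ht]

/-- Conversely to `hilbertBall_subset`, up to a constant that depends on the centre. -/
theorem exists_subset_hilbertBall (ho : IsOpen Ω) (hc : Convex ℝ Ω) (hb : Bornology.IsBounded Ω)
    (hx : x ∈ Ω) : ∃ C : ℝ, 1 ≤ C ∧ ∀ R t : ℝ, C * Real.exp (-(2 * R)) < t → t ≤ 1 →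
      {y | y ∈ Ω ∧ y + t • (y - x) ∈ Ω} ⊆ hilbertBall Ω x R := by
  obtain ⟨ρ, hρ, hρΩ⟩ := Metric.isOpen_iff.1 ho x hx
  obtain ⟨D, hD⟩ := hb.subset_closedBall x
  have hD0 : 0 ≤ D := by simpa using hD hx
  refine ⟨2 * (1 + D / ρ), by have := div_nonneg hD0 hρ.le; linarith, fun R t ht ht1 y hy => ?_⟩
  obtain ⟨hy, hyt⟩ := hy
  have ht0 : 0 < t := lt_of_le_of_lt (by positivity) ht
  refine ⟨hy, ?_⟩
  have hs : gaugeAt Ω x (x - y) ≤ D / ρ := by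
    have h1 : ρ * gaugeAt Ω x (x - y) ≤ ‖x - y‖ := by
      refine mul_gauge_le_norm fun u hu => hρΩ ?_
      simpa using hu
    have h2 : ‖x - y‖ ≤ D := by
      have := hD hy
      rwa [Metric.mem_closedBall, dist_comm, dist_eq_norm] at this
    rw [le_div_iff₀ hρ]
    linarith
  have ht' : gaugeAt Ω y (y - x) < 1 / t := by
    rw [← gaugeAt_lt_one_iff ho hc hy, gaugeAt_smul ht0.le] at hyt
    rw [lt_div_iff₀ ht0]
    linarith
  have hs0 : 0 ≤ gaugeAt Ω x (x - y) := gaugeAt_nonneg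
  have ht0' : 0 ≤ gaugeAt Ω y (y - x) := gaugeAt_nonneg
  rw [hilbertDist_eq ho hc hb hx hy]
  have hlog : Real.log ((1 + gaugeAt Ω x (x - y)) * (1 + gaugeAt Ω y (y - x))) < 2 * R := by
    rw [Real.log_lt_iff_lt_exp (by positivity)]
    have h3 : 2 * (1 + D / ρ) < t * Real.exp (2 * R) := by
      have := mul_lt_mul_of_pos_right ht (Real.exp_pos (2 * R))
      rwa [mul_assoc, ← Real.exp_add, neg_add_cancel, Real.exp_zero, mul_one] at this
    have h4 : 1 + 1 / t ≤ 2 / t := by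
      have : 1 ≤ 1 / t := (one_le_div ht0).2 ht1
      have h5 : 2 / t = 1 / t + 1 / t := by ring
      linarith
    calc (1 + gaugeAt Ω x (x - y)) * (1 + gaugeAt Ω y (y - x))
        ≤ (1 + D / ρ) * (2 / t) := by
          apply mul_le_mul <;> linarith
      _ = 2 * (1 + D / ρ) / t := by ring
      _ < Real.exp (2 * R) := by rwa [div_lt_iff₀ ht0, mul_comm (Real.exp _)]
  linarith

theorem ofReal_one_sq_mul_pi :
    ENNReal.ofReal 1 ^ 2 * (NNReal.pi : ENNReal) = ENNReal.ofReal Real.pi := by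
  rw [← NNReal.coe_real_pi, ENNReal.ofReal_coe_nnreal]
  simp

/-- A set of vectors `v` with `x ± v ∈ Ω` lies in the unit disc of the Finsler norm. -/
theorem busemann_le (ho : IsOpen Ω) (hc : Convex ℝ Ω) (hb : Bornology.IsBounded Ω)
    (hx : x ∈ Ω) {S : Set ℂ} (hS : ∀ v ∈ S, x + v ∈ Ω ∧ x - v ∈ Ω) :
    busemann Ω x ≤ ENNReal.ofReal Real.pi / volume S := by
  rw [busemann, Complex.volume_ball]
  have h1 : S ⊆ {v : ℂ | finslerNorm Ω x v < 1} := by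
    intro v hv
    obtain ⟨h1, h2⟩ := hS v hv
    rw [← gaugeAt_lt_one_iff ho hc hx] at h1
    rw [sub_eq_add_neg, ← gaugeAt_lt_one_iff ho hc hx] at h2
    rw [mem_ofPred_eq, finslerNorm_eq ho hc hb hx]
    linarith
  refine ENNReal.div_le_div (le_of_eq ?_) (measure_mono h1)
  exact ofReal_one_sq_mul_pi

open scoped Pointwise in
/-- The unit disc of the Finsler norm is contained in twice the set of the `v` with `x ± v ∈ Ω`;
this set is covered by `H` and `-H`. -/
theorem le_busemann (ho : IsOpen Ω) (hc : Convex ℝ Ω) (hb : Bornology.IsBounded Ω)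
    (hx : x ∈ Ω) {H : Set ℂ} (hH : ∀ v, x + v ∈ Ω → x - v ∈ Ω → v ∈ H ∨ -v ∈ H) :
    ENNReal.ofReal Real.pi / (8 * volume H) ≤ busemann Ω x := by
  rw [busemann, Complex.volume_ball]
  have h1 : {v : ℂ | finslerNorm Ω x v < 1} ⊆ (2 : ℝ) • (H ∪ -H) := by
    intro v hv
    rw [mem_ofPred_eq, finslerNorm_eq ho hc hb hx] at hv
    rw [mem_smul_set_iff_inv_smul_mem₀ two_ne_zero]
    have g1 : 0 ≤ gaugeAt Ω x v := gaugeAt_nonneg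
    have g2 : 0 ≤ gaugeAt Ω x (-v) := gaugeAt_nonneg
    have a1 : x + (2 : ℝ)⁻¹ • v ∈ Ω := by
      rw [← gaugeAt_lt_one_iff ho hc hx, gaugeAt_smul (by norm_num)]
      linarith
    have a2 : x - (2 : ℝ)⁻¹ • v ∈ Ω := by
      rw [sub_eq_add_neg, ← smul_neg, ← gaugeAt_lt_one_iff ho hc hx, gaugeAt_smul (by norm_num)]
      linarith
    exact hH _ a1 a2
  have h2 : volume {v : ℂ | finslerNorm Ω x v < 1} ≤ 8 * volume H := by
    calc volume {v : ℂ | finslerNorm Ω x v < 1} ≤ volume ((2 : ℝ) • (H ∪ -H)) := measure_mono h1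
      _ = 4 * volume (H ∪ -H) := by
        rw [Measure.addHaar_smul, Complex.finrank_real_complex]
        norm_num
      _ ≤ 4 * (volume H + volume H) := by
        gcongr
        exact (measure_union_le _ _).trans (by rw [Measure.measure_neg])
      _ = 8 * volume H := by ring
  refine ENNReal.div_le_div (le_of_eq ?_) h2
  exact ofReal_one_sq_mul_pi.symm

theorem hilbertMeasure_apply {A : Set ℂ} (hA : A ⊆ Ω) :
    hilbertMeasure Ω A = ∫⁻ y in A, busemann Ω y := by
  rw [hilbertMeasure, withDensity_apply', Measure.restrict_restrict_of_subset hA]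

end HilbertGeometry

/-! ### Self-similarity of the Cantor-Lebesgue function -/

namespace CantorLebesgue

open HilbertGeometry

variable {p : ℝ}

/-- A refinement on `[a, b]` is an affine copy of the refinement on `[0, 1]`. -/
theorem refine_eq_approx (hp : 2 < p) (n : ℕ) : ∀ a b c d x : ℝ, a < b →
    refine p n a b c d x = c + (d - c) * approx p n ((x - a) / (b - a)) := by
  have hp0 : 0 < p := by linarith
  induction n with
  | zero =>
    intro a b c d x hab
    simp [refine, approx]
  | succ n ih =>
    intro a b c d x hab
    have hba : 0 < b - a := by linarith
    have hl : 0 < (b - a) / p := div_pos hba hp0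
    have hl' : 0 < (1 - 0) / p := div_pos (by norm_num) hp0
    have c1 : x ≤ a + (b - a) / p ↔ (x - a) / (b - a) ≤ 0 + (1 - 0) / p := by
      rw [div_le_iff₀ hba, zero_add, sub_zero, one_div, inv_mul_eq_div]
      constructor <;> intro h <;> linarith
    have c2 : x < b - (b - a) / p ↔ (x - a) / (b - a) < 1 - (1 - 0) / p := by
      rw [div_lt_iff₀ hba, sub_zero, sub_mul, one_mul, one_div, inv_mul_eq_div]
      constructor <;> intro h <;> linarith
    rw [approx, refine, refine]
    simp only [c1, c2]
    split_ifs with h1 h2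
    · rw [ih _ _ _ _ _ (by linarith), ih _ _ _ _ _ (by linarith)]
      have : (x - a) / (a + (b - a) / p - a) =
          ((x - a) / (b - a) - 0) / (0 + (1 - 0) / p - 0) := by
        rw [add_sub_cancel_left, sub_zero, sub_zero, sub_zero, zero_add]
        field_simp
      rw [this]
      ring
    · ring
    · have h3 : b - (b - a) / p < b := by linarith
      rw [ih _ _ _ _ _ h3, ih _ _ _ _ _ (by linarith)]
      have : (x - (b - (b - a) / p)) / (b - (b - (b - a) / p)) =
          ((x - a) / (b - a) - (1 - (1 - 0) / p)) / (1 - (1 - (1 - 0) / p)) := by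
        rw [sub_sub_cancel, sub_sub_cancel, sub_zero]
        field_simp
        ring
      rw [this]
      ring

theorem approx_succ (hp : 2 < p) (n : ℕ) (x : ℝ) :
    approx p (n + 1) x =
      if x ≤ 1 / p then approx p n (p * x) / 2
      else if x < 1 - 1 / p then 1 / 2
      else 1 / 2 + approx p n (p * x - (p - 1)) / 2 := by
  have hp0 : 0 < p := by linarith
  have hl : 0 < 1 / p := by positivity
  rw [approx, refine]
  simp only [zero_add, sub_zero]
  split_ifs with h1 h2
  · rw [refine_eq_approx hp n _ _ _ _ _ hl]
    have : (x - 0) / (1 / p - 0) = p * x := by field_simp; ring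
    rw [this]; ring
  · rfl
  · rw [refine_eq_approx hp n _ _ _ _ _ (by linarith)]
    have : (x - (1 - 1 / p)) / (1 - (1 - 1 / p)) = p * x - (p - 1) := by field_simp; ring
    rw [this]; ring

theorem approx_mem (hp : 2 < p) (n : ℕ) {x : ℝ} (hx : x ∈ Icc (0 : ℝ) 1) :
    approx p n x ∈ Icc (0 : ℝ) 1 :=
  refine_mem p hp n 0 1 0 1 x (by norm_num) (by norm_num) hx.1 hx.2

theorem mul_mem_of_le (hp : 2 < p) {x : ℝ} (hx : x ∈ Icc (0 : ℝ) 1) (h : x ≤ 1 / p) :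
    p * x ∈ Icc (0 : ℝ) 1 := by
  have hp0 : 0 < p := by linarith
  rw [le_div_iff₀ hp0] at h
  exact ⟨mul_nonneg hp0.le hx.1, by linarith⟩

theorem mul_sub_mem_of_le (hp : 2 < p) {x : ℝ} (hx : x ∈ Icc (0 : ℝ) 1) (h : 1 - 1 / p ≤ x) :
    p * x - (p - 1) ∈ Icc (0 : ℝ) 1 := by
  have hp0 : 0 < p := by linarith
  have h1 := mul_le_mul_of_nonneg_left h hp0.le
  rw [mul_sub, mul_one_div_cancel hp0.ne'] at h1
  have h2 := mul_le_mul_of_nonneg_left hx.2 hp0.le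
  constructor <;> linarith

theorem approx_monotoneOn (hp : 2 < p) (n : ℕ) : MonotoneOn (approx p n) (Icc 0 1) := by
  have hp0 : 0 < p := by linarith
  induction n with
  | zero => intro x _ y _ h; simpa [approx, refine] using h
  | succ n ih =>
    intro x hx y hy h
    have hpxy : p * x ≤ p * y := mul_le_mul_of_nonneg_left h hp0.le
    rw [approx_succ hp, approx_succ hp]
    split_ifs with h1 h2 h3 h4 h5 h6 h7 h8
    · have := ih (mul_mem_of_le hp hx h1) (mul_mem_of_le hp hy h2) hpxy
      linarith
    · have := (approx_mem hp n (mul_mem_of_le hp hx h1)).2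
      linarith
    · have := (approx_mem hp n (mul_mem_of_le hp hx h1)).2
      have := (approx_mem hp n (mul_sub_mem_of_le hp hy (not_lt.1 h3))).1
      linarith
    · linarith
    · linarith
    · have := (approx_mem hp n (mul_sub_mem_of_le hp hy (not_lt.1 h6))).1
      linarith
    · linarith
    · linarith
    · have := ih (mul_sub_mem_of_le hp hx (not_lt.1 h4)) (mul_sub_mem_of_le hp hy (not_lt.1 h8))
        (by linarith)
      linarith

theorem cantorLebesgue_mem (hp : 2 < p) {x : ℝ} (hx : x ∈ Icc (0 : ℝ) 1) :
    cantorLebesgue p x ∈ Icc (0 : ℝ) 1 :=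
  isClosed_Icc.mem_of_tendsto (tendsto_approx p hp x hx)
    (Eventually.of_forall fun n => approx_mem hp n hx)

theorem cantorLebesgue_monotoneOn (hp : 2 < p) : MonotoneOn (cantorLebesgue p) (Icc 0 1) :=
  fun x hx y hy h => le_of_tendsto_of_tendsto' (tendsto_approx p hp x hx)
    (tendsto_approx p hp y hy) fun n => approx_monotoneOn hp n hx hy h

theorem div_mem (hp : 2 < p) {x : ℝ} (hx : x ∈ Icc (0 : ℝ) 1) : x / p ∈ Icc (0 : ℝ) 1 := by
  have hp0 : 0 < p := by linarith
  exact ⟨div_nonneg hx.1 hp0.le, by rw [div_le_one hp0]; linarith [hx.2]⟩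

theorem right_mem (hp : 2 < p) {x : ℝ} (hx : x ∈ Icc (0 : ℝ) 1) :
    1 - 1 / p + x / p ∈ Icc (0 : ℝ) 1 := by
  have hp0 : 0 < p := by linarith
  have h1 : 1 / p ≤ 1 := by rw [div_le_one hp0]; linarith
  have h2 := div_nonneg hx.1 hp0.le
  have h3 : x / p ≤ 1 / p := div_le_div_of_nonneg_right hx.2 hp0.le
  constructor <;> linarith

theorem cantorLebesgue_left (hp : 2 < p) {x : ℝ} (hx : x ∈ Icc (0 : ℝ) 1) :
    cantorLebesgue p (x / p) = cantorLebesgue p x / 2 := by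
  have hp0 : 0 < p := by linarith
  refine tendsto_nhds_unique
    ((tendsto_approx p hp _ (div_mem hp hx)).comp (tendsto_add_atTop_nat 1))
    (((tendsto_approx p hp x hx).div_const 2).congr fun n => ?_)
  rw [Function.comp, approx_succ hp, if_pos (div_le_div_of_nonneg_right hx.2 hp0.le),
    mul_div_cancel₀ _ hp0.ne']

theorem cantorLebesgue_right (hp : 2 < p) {x : ℝ} (hx : x ∈ Icc (0 : ℝ) 1) :
    cantorLebesgue p (1 - 1 / p + x / p) = 1 / 2 + cantorLebesgue p x / 2 := by
  have hp0 : 0 < p := by linarith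
  have h1 : 1 / p < 1 / 2 := one_div_lt_one_div_of_lt two_pos hp
  have h2 := div_nonneg hx.1 hp0.le
  refine tendsto_nhds_unique
    ((tendsto_approx p hp _ (right_mem hp hx)).comp (tendsto_add_atTop_nat 1))
    ((((tendsto_approx p hp x hx).div_const 2).const_add (1 / 2)).congr fun n => ?_)
  rw [Function.comp, approx_succ hp, if_neg (by linarith), if_neg (by linarith)]
  congr 3
  field_simp
  ring

theorem cantorLebesgue_zero (hp : 2 < p) : cantorLebesgue p 0 = 0 := by
  have := cantorLebesgue_left hp (x := 0) (by simp)
  rw [zero_div] at this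
  linarith

theorem cantorLebesgue_one (hp : 2 < p) : cantorLebesgue p 1 = 1 := by
  have := cantorLebesgue_right hp (x := 1) (by simp)
  rw [sub_add_cancel] at this
  linarith

/-- The left end of the `k`-th interval, from the left, among the `2 ^ n` intervals of length
`p ⁻ⁿ` on which `approx p n` is increasing. The values for `k ≥ 2 ^ n` are irrelevant. -/
def arcLeft (p : ℝ) : ℕ → ℕ → ℝ
  | 0, _ => 0
  | n + 1, k => if k < 2 ^ n then arcLeft p n k / p else 1 - 1 / p + arcLeft p n (k - 2 ^ n) / p

/-- The right end of the interval with left end `arcLeft p n k`. -/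
def arcRight (p : ℝ) (n k : ℕ) : ℝ :=
  arcLeft p n k + 1 / p ^ n

/-- On the `k`-th interval of stage `n` the function is a copy of itself, scaled by `p ⁻ⁿ` in the
argument and by `2 ⁻ⁿ` in the value. -/
theorem arcLeft_add_mem (hp : 2 < p) (n : ℕ) : ∀ k : ℕ, k < 2 ^ n → ∀ x ∈ Icc (0 : ℝ) 1,
    arcLeft p n k + x / p ^ n ∈ Icc (0 : ℝ) 1 ∧
      cantorLebesgue p (arcLeft p n k + x / p ^ n) = (k + cantorLebesgue p x) / 2 ^ n := by
  have hp0 : 0 < p := by linarith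
  induction n with
  | zero =>
    intro k hk x hx
    have : k = 0 := by simpa using hk
    subst this
    simpa [arcLeft] using hx
  | succ n ih =>
    intro k hk x hx
    rw [arcLeft]
    split_ifs with h
    · obtain ⟨h1, h2⟩ := ih k h x hx
      have e : arcLeft p n k / p + x / p ^ (n + 1) = (arcLeft p n k + x / p ^ n) / p := by
        rw [pow_succ]; field_simp
      rw [e, cantorLebesgue_left hp h1, h2]
      exact ⟨div_mem hp h1, by rw [pow_succ]; field_simp⟩
    · have h' : k - 2 ^ n < 2 ^ n := by rw [pow_succ] at hk; omega
      obtain ⟨h1, h2⟩ := ih (k - 2 ^ n) h' x hx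
      have e : 1 - 1 / p + arcLeft p n (k - 2 ^ n) / p + x / p ^ (n + 1) =
          1 - 1 / p + (arcLeft p n (k - 2 ^ n) + x / p ^ n) / p := by
        rw [pow_succ]; field_simp; ring
      rw [e, cantorLebesgue_right hp h1, h2, Nat.cast_sub (not_lt.1 h)]
      refine ⟨right_mem hp h1, ?_⟩
      push_cast
      rw [pow_succ]
      field_simp
      ring

theorem arcLeft_mem (hp : 2 < p) {n k : ℕ} (hk : k < 2 ^ n) : arcLeft p n k ∈ Icc (0 : ℝ) 1 := by
  simpa using (arcLeft_add_mem hp n k hk 0 (by simp)).1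

theorem arcRight_mem (hp : 2 < p) {n k : ℕ} (hk : k < 2 ^ n) : arcRight p n k ∈ Icc (0 : ℝ) 1 :=
  (arcLeft_add_mem hp n k hk 1 (by simp)).1

theorem cantorLebesgue_arcLeft (hp : 2 < p) {n k : ℕ} (hk : k < 2 ^ n) :
    cantorLebesgue p (arcLeft p n k) = k / 2 ^ n := by
  simpa [cantorLebesgue_zero hp] using (arcLeft_add_mem hp n k hk 0 (by simp)).2

theorem cantorLebesgue_arcRight (hp : 2 < p) {n k : ℕ} (hk : k < 2 ^ n) :
    cantorLebesgue p (arcRight p n k) = (k + 1) / 2 ^ n := by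
  have := (arcLeft_add_mem hp n k hk 1 (by simp)).2
  rwa [cantorLebesgue_one hp] at this

theorem arcLeft_zero (n : ℕ) : arcLeft p n 0 = 0 := by
  induction n with
  | zero => rfl
  | succ n ih => simp [arcLeft, ih]

theorem arcRight_last (hp : 2 < p) (n : ℕ) : arcRight p n (2 ^ n - 1) = 1 := by
  have hp0 : 0 < p := by linarith
  induction n with
  | zero => simp [arcRight, arcLeft]
  | succ n ih =>
    have h1 : ¬ (2 ^ (n + 1) - 1 < 2 ^ n) := by
      have := Nat.one_le_two_pow (n := n)
      rw [pow_succ]; omega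
    have h2 : 2 ^ (n + 1) - 1 - 2 ^ n = 2 ^ n - 1 := by
      rw [pow_succ]; omega
    rw [arcRight, arcLeft, if_neg h1, h2]
    rw [arcRight] at ih
    have : arcLeft p n (2 ^ n - 1) = 1 - 1 / p ^ n := by linarith
    rw [this, pow_succ]
    field_simp
    ring

theorem arcRight_lt_arcLeft_succ (hp : 2 < p) (n : ℕ) : ∀ k : ℕ, k + 1 < 2 ^ n →
    arcRight p n k < arcLeft p n (k + 1) := by
  have hp0 : 0 < p := by linarith
  induction n with
  | zero => intro k hk; simp at hk
  | succ n ih =>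
    intro k hk
    have e1 : ∀ j, arcLeft p n j / p + 1 / p ^ (n + 1) = arcRight p n j / p := by
      intro j
      rw [arcRight, pow_succ]; field_simp
    rcases lt_trichotomy (k + 1) (2 ^ n) with h | h | h
    · rw [arcRight, arcLeft, arcLeft, if_pos (by omega), if_pos h, e1]
      exact div_lt_div_of_pos_right (ih k h) hp0
    · have hk' : k = 2 ^ n - 1 := by omega
      rw [arcRight, arcLeft, arcLeft, if_pos (by omega), if_neg (by omega), e1, h, Nat.sub_self,
        arcLeft_zero, hk', arcRight_last hp]
      have h1 : 1 / p < 1 / 2 := one_div_lt_one_div_of_lt two_pos hp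
      simp only [zero_div, add_zero]
      linarith
    · have h2 : k - 2 ^ n + 1 < 2 ^ n := by rw [pow_succ] at hk; omega
      rw [arcRight, arcLeft, arcLeft, if_neg (by omega), if_neg (by omega), add_assoc, e1,
        show k + 1 - 2 ^ n = k - 2 ^ n + 1 by omega]
      have := div_lt_div_of_pos_right (ih _ h2) hp0
      linarith

/-- At every stage, the increasing intervals and the flat ones between them cover `[0, 1]`. -/
theorem exists_mem_arc_or_gap (hp : 2 < p) (n : ℕ) : ∀ t ∈ Icc (0 : ℝ) 1,
    (∃ k < 2 ^ n, t ∈ Icc (arcLeft p n k) (arcRight p n k)) ∨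
      ∃ k, k + 1 < 2 ^ n ∧ t ∈ Icc (arcRight p n k) (arcLeft p n (k + 1)) := by
  have hp0 : 0 < p := by linarith
  induction n with
  | zero => intro t ht; left; exact ⟨0, by simp, by simpa [arcLeft, arcRight] using ht⟩
  | succ n ih =>
    intro t ht
    have e1 : ∀ j, j < 2 ^ n → arcLeft p (n + 1) j = arcLeft p n j / p := fun j hj => by
      rw [arcLeft, if_pos hj]
    have e2 : ∀ j, j < 2 ^ n → arcRight p (n + 1) j = arcRight p n j / p := fun j hj => by
      rw [arcRight, e1 j hj, arcRight, pow_succ]; field_simp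
    have e3 : ∀ j, arcLeft p (n + 1) (j + 2 ^ n) = 1 - 1 / p + arcLeft p n j / p := fun j => by
      rw [arcLeft, if_neg (by omega), Nat.add_sub_cancel]
    have e4 : ∀ j, arcRight p (n + 1) (j + 2 ^ n) = 1 - 1 / p + arcRight p n j / p := fun j => by
      rw [arcRight, e3 j, arcRight, pow_succ]; field_simp; ring
    have e5 : 1 - 1 / p = (p - 1) / p := by field_simp
    have hpow : 2 ^ (n + 1) = 2 ^ n + 2 ^ n := by rw [pow_succ]; ring
    rcases le_or_gt t (1 / p) with h | h
    · rcases ih _ (mul_mem_of_le hp ht h) with ⟨k, hk, h1, h2⟩ | ⟨k, hk, h1, h2⟩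
      · left
        refine ⟨k, by omega, ?_, ?_⟩
        · rw [e1 k hk, div_le_iff₀ hp0]; linarith
        · rw [e2 k hk, le_div_iff₀ hp0]; linarith
      · right
        refine ⟨k, by omega, ?_, ?_⟩
        · rw [e2 k (by omega), div_le_iff₀ hp0]; linarith
        · rw [e1 _ hk, le_div_iff₀ hp0]; linarith
    rcases le_or_gt (1 - 1 / p) t with h' | h'
    · rcases ih _ (mul_sub_mem_of_le hp ht h') with ⟨k, hk, h1, h2⟩ | ⟨k, hk, h1, h2⟩
      · left
        refine ⟨k + 2 ^ n, by omega, ?_, ?_⟩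
        · rw [e3, e5, ← add_div, div_le_iff₀ hp0]; linarith
        · rw [e4, e5, ← add_div, le_div_iff₀ hp0]; linarith
      · right
        refine ⟨k + 2 ^ n, by omega, ?_, ?_⟩
        · rw [e4, e5, ← add_div, div_le_iff₀ hp0]; linarith
        · rw [show k + 2 ^ n + 1 = k + 1 + 2 ^ n by ring, e3, e5, ← add_div, le_div_iff₀ hp0]
          linarith
    · right
      have h1 := Nat.one_le_two_pow (n := n)
      refine ⟨2 ^ n - 1, by omega, ?_, ?_⟩
      · rw [e2 _ (by omega), arcRight_last hp]; exact h.le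
      · rw [show 2 ^ n - 1 + 1 = 0 + 2 ^ n by omega, e3, arcLeft_zero]; simpa using h'.le

/-! ### The cross product of plane vectors -/

/-- The determinant of the pair of plane vectors `(z, w)`. -/
def cross (z w : ℂ) : ℝ :=
  z.re * w.im - z.im * w.re

theorem cross_swap (z w : ℂ) : cross z w = -cross w z := by simp only [cross]; ring

theorem cross_self (z : ℂ) : cross z z = 0 := by simp only [cross]; ring

theorem cross_add_left (z z' w : ℂ) : cross (z + z') w = cross z w + cross z' w := by
  simp only [cross, Complex.add_re, Complex.add_im]; ring

theorem cross_add_right (z w w' : ℂ) : cross z (w + w') = cross z w + cross z w' := by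
  simp only [cross, Complex.add_re, Complex.add_im]; ring

theorem cross_sub_left (z z' w : ℂ) : cross (z - z') w = cross z w - cross z' w := by
  simp only [cross, Complex.sub_re, Complex.sub_im]; ring

theorem cross_sub_right (z w w' : ℂ) : cross z (w - w') = cross z w - cross z w' := by
  simp only [cross, Complex.sub_re, Complex.sub_im]; ring

theorem cross_neg_left (z w : ℂ) : cross (-z) w = -cross z w := by
  simp only [cross, Complex.neg_re, Complex.neg_im]; ring

theorem cross_neg_right (z w : ℂ) : cross z (-w) = -cross z w := by
  simp only [cross, Complex.neg_re, Complex.neg_im]; ring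

theorem cross_smul_left (a : ℝ) (z w : ℂ) : cross (a • z) w = a * cross z w := by
  simp only [cross, Complex.real_smul, Complex.re_ofReal_mul, Complex.im_ofReal_mul]; ring

theorem cross_smul_right (a : ℝ) (z w : ℂ) : cross z (a • w) = a * cross z w := by
  simp only [cross, Complex.real_smul, Complex.re_ofReal_mul, Complex.im_ofReal_mul]; ring

theorem abs_cross_le (z w : ℂ) : |cross z w| ≤ ‖z‖ * ‖w‖ := by
  rw [← Real.sqrt_sq (norm_nonneg z), ← Real.sqrt_sq (norm_nonneg w), ← Real.sqrt_mul (sq_nonneg _)]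
  refine Real.abs_le_sqrt ?_
  rw [← Complex.normSq_eq_norm_sq, ← Complex.normSq_eq_norm_sq, Complex.normSq_apply,
    Complex.normSq_apply, cross]
  nlinarith [sq_nonneg (z.re * w.re + z.im * w.im)]

theorem continuous_cross_right (z : ℂ) : Continuous (cross z) := by
  unfold cross; fun_prop

theorem eq_smul_of_cross_eq_zero {z w : ℂ} (hw : w ≠ 0) (h : cross z w = 0) :
    ∃ c : ℝ, z = c • w := by
  have hn : w.re * w.re + w.im * w.im ≠ 0 := by
    rw [← Complex.normSq_apply]; exact (Complex.normSq_pos.2 hw).ne'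
  refine ⟨(z.re * w.re + z.im * w.im) / (w.re * w.re + w.im * w.im), ?_⟩
  rw [cross] at h
  apply Complex.ext
  · rw [Complex.real_smul, Complex.re_ofReal_mul, div_mul_eq_mul_div, eq_div_iff hn]
    linear_combination w.im * h
  · rw [Complex.real_smul, Complex.im_ofReal_mul, div_mul_eq_mul_div, eq_div_iff hn]
    linear_combination -w.re * h

/-- Cramer's rule in the plane. -/
theorem eq_add_smul_of_cross_ne_zero {u v : ℂ} (h : cross u v ≠ 0) (z : ℂ) :
    z = (cross z v / cross u v) • u + (cross u z / cross u v) • v := by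
  apply Complex.ext
  · simp only [Complex.add_re, Complex.real_smul, Complex.re_ofReal_mul]
    field_simp
    simp only [cross]
    ring
  · simp only [Complex.add_im, Complex.real_smul, Complex.im_ofReal_mul]
    field_simp
    simp only [cross]
    ring

theorem convex_setOf_cross_nonneg (a z : ℂ) : Convex ℝ {w | 0 ≤ cross z (w - a)} := by
  intro x hx y hy s t hs ht hst
  rw [mem_ofPred_eq] at *
  have : s • x + t • y - a = s • (x - a) + t • (y - a) := by
    rw [smul_sub, smul_sub, ← sub_eq_zero]
    have h : s • a + t • a = a := by rw [← add_smul, hst, one_smul]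
    linear_combination (exp := 1) h
  rw [this, cross_add_right, cross_smul_right, cross_smul_right]
  positivity

/-- A point of a triangle with barycentric coordinates at least `1 / 4` is the centre of a disc,
of radius controlled by the area and the sides at one vertex, inside the triangle. -/
theorem ball_subset_of_triangle {K : Set ℂ} (hK : Convex ℝ K) {a b c : ℂ} (ha : a ∈ K) (hb : b ∈ K)
    (hc : c ∈ K) {h ρ : ℝ} (hh : 0 < h) (hab : ‖b - a‖ ≤ h) (hac : ‖c - a‖ ≤ h) (hρ : 0 < ρ)
    (hD : 8 * ρ * h ≤ cross (b - a) (c - a)) {x x' : ℝ} (hx : 1 / 4 ≤ x) (hx' : 1 / 4 ≤ x')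
    (hxx : x + x' ≤ 3 / 4) : Metric.ball (a + x • (b - a) + x' • (c - a)) ρ ⊆ K := by
  intro z hz
  set y := a + x • (b - a) + x' • (c - a)
  set D := cross (b - a) (c - a) with hDdef
  have hD0 : 0 < D := lt_of_lt_of_le (by positivity) hD
  have hu : ‖z - y‖ ≤ ρ := by rw [← dist_eq_norm]; exact (Metric.mem_ball.1 hz).le
  have e1 : |cross (z - y) (c - a) / D| ≤ 1 / 8 := by
    rw [abs_div, abs_of_pos hD0, div_le_iff₀ hD0]
    have := abs_cross_le (z - y) (c - a)
    have : ‖z - y‖ * ‖c - a‖ ≤ ρ * h := by gcongr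
    linarith
  have e2 : |cross (b - a) (z - y) / D| ≤ 1 / 8 := by
    rw [abs_div, abs_of_pos hD0, div_le_iff₀ hD0]
    have := abs_cross_le (b - a) (z - y)
    have : ‖b - a‖ * ‖z - y‖ ≤ h * ρ := by gcongr
    linarith
  have e3 := eq_add_smul_of_cross_ne_zero hD0.ne' (z - y)
  rw [← hDdef] at e3
  set α := cross (z - y) (c - a) / D
  set β := cross (b - a) (z - y) / D
  rw [abs_le] at e1 e2
  have e4 : z = (1 - (x + α) - (x' + β)) • a + (x + α) • b + (x' + β) • c := by
    have : z = y + (z - y) := by ring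
    rw [this, e3]
    simp only [y]
    module
  have := hK.sum_mem (t := Finset.univ) (w := ![1 - (x + α) - (x' + β), x + α, x' + β])
    (z := ![a, b, c]) (by intro i _; fin_cases i <;> simp <;> linarith)
    (by simp [Fin.sum_univ_three]; ring) (by intro i _; fin_cases i <;> simp [ha, hb, hc])
  rw [e4]
  simpa [Fin.sum_univ_three] using this

/-! ### The curve and its tangents -/

/-- The unit tangent vector of `curve p` at time `s`. -/
def tangent (p s : ℝ) : ℂ :=
  Complex.exp (Complex.I * (Real.pi * cantorLebesgue p s : ℝ))

theorem tangent_re (s : ℝ) : (tangent p s).re = Real.cos (Real.pi * cantorLebesgue p s) := by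
  rw [tangent, mul_comm, Complex.exp_ofReal_mul_I_re]

theorem tangent_im (s : ℝ) : (tangent p s).im = Real.sin (Real.pi * cantorLebesgue p s) := by
  rw [tangent, mul_comm, Complex.exp_ofReal_mul_I_im]

theorem norm_tangent (s : ℝ) : ‖tangent p s‖ = 1 := by
  rw [tangent, mul_comm, Complex.norm_exp_ofReal_mul_I]

theorem cross_tangent (s u : ℝ) : cross (tangent p s) (tangent p u) =
    Real.sin (Real.pi * (cantorLebesgue p u - cantorLebesgue p s)) := by
  rw [cross, tangent_re, tangent_re, tangent_im, tangent_im, mul_sub, Real.sin_sub]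
  ring

theorem integrableOn_tangent (hp : 2 < p) : IntegrableOn (tangent p) (Icc 0 1) := by
  have hm : AEMeasurable (cantorLebesgue p) (volume.restrict (Icc (0 : ℝ) 1)) :=
    aemeasurable_restrict_of_monotoneOn measurableSet_Icc (cantorLebesgue_monotoneOn hp)
  have hc : Continuous fun x : ℝ => Complex.exp (Complex.I * (Real.pi * x : ℝ)) := by fun_prop
  exact Integrable.of_bound (hc.measurable.comp_aemeasurable hm).aestronglyMeasurable 1
    (Eventually.of_forall fun s => (norm_tangent s).le)

theorem intervalIntegrable_tangent (hp : 2 < p) {s t : ℝ} (hs : s ∈ Icc (0 : ℝ) 1)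
    (ht : t ∈ Icc (0 : ℝ) 1) : IntervalIntegrable (tangent p) volume s t := by
  rw [intervalIntegrable_iff]
  exact (integrableOn_tangent hp).mono_set (uIoc_subset_uIcc.trans
    ((convex_Icc (0 : ℝ) 1).ordConnected.uIcc_subset hs ht))

theorem curve_sub (hp : 2 < p) {s t : ℝ} (hs : s ∈ Icc (0 : ℝ) 1) (ht : t ∈ Icc (0 : ℝ) 1) :
    curve p t - curve p s = ∫ u in s..t, tangent p u :=
  intervalIntegral.integral_interval_sub_left
    (intervalIntegrable_tangent hp (by simp) ht) (intervalIntegrable_tangent hp (by simp) hs)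

theorem norm_curve_sub_le (hp : 2 < p) {s t : ℝ} (hs : s ∈ Icc (0 : ℝ) 1)
    (ht : t ∈ Icc (0 : ℝ) 1) : ‖curve p t - curve p s‖ ≤ |t - s| := by
  rw [curve_sub hp hs ht]
  simpa using intervalIntegral.norm_integral_le_of_norm_le_const (a := s) (b := t)
    (f := tangent p) (C := 1) fun u _ => (norm_tangent u).le

theorem cross_curve_sub (hp : 2 < p) (z : ℂ) {s t : ℝ} (hs : s ∈ Icc (0 : ℝ) 1)
    (ht : t ∈ Icc (0 : ℝ) 1) :
    cross z (curve p t - curve p s) = ∫ u in s..t, cross z (tangent p u) := by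
  rw [curve_sub hp hs ht]
  exact ((z.re • Complex.imCLM - z.im • Complex.reCLM).intervalIntegral_comp_comm
    (intervalIntegrable_tangent hp hs ht)).symm

theorem intervalIntegrable_cross (hp : 2 < p) (z : ℂ) {s t : ℝ} (hs : s ∈ Icc (0 : ℝ) 1)
    (ht : t ∈ Icc (0 : ℝ) 1) :
    IntervalIntegrable (fun u => cross z (tangent p u)) volume s t := by
  have h := intervalIntegrable_tangent hp hs ht
  exact ⟨(z.re • Complex.imCLM - z.im • Complex.reCLM).integrable_comp h.1,
    (z.re • Complex.imCLM - z.im • Complex.reCLM).integrable_comp h.2⟩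

theorem le_cross_curve_sub (hp : 2 < p) {z : ℂ} {s t c : ℝ} (hs : s ∈ Icc (0 : ℝ) 1)
    (ht : t ∈ Icc (0 : ℝ) 1) (hst : s ≤ t) (hc : ∀ u ∈ Icc s t, c ≤ cross z (tangent p u)) :
    c * (t - s) ≤ cross z (curve p t - curve p s) := by
  rw [cross_curve_sub hp z hs ht]
  have := intervalIntegral.integral_mono_on hst intervalIntegrable_const
    (intervalIntegrable_cross hp z hs ht) hc
  rw [intervalIntegral.integral_const, smul_eq_mul] at this
  linarith

theorem cross_curve_sub_le (hp : 2 < p) {z : ℂ} {s t c : ℝ} (hs : s ∈ Icc (0 : ℝ) 1)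
    (ht : t ∈ Icc (0 : ℝ) 1) (hst : s ≤ t) (hc : ∀ u ∈ Icc s t, cross z (tangent p u) ≤ c) :
    cross z (curve p t - curve p s) ≤ c * (t - s) := by
  have := le_cross_curve_sub hp (z := -z) (c := -c) hs ht hst fun u hu => by
    rw [cross_neg_left]; linarith [hc u hu]
  rw [cross_neg_left] at this
  linarith

/-- The cross product of two chords is the integral of `sin (π (f v - f u))` over the product
of the two time intervals, hence a lower bound on the sine gives one on the cross product. -/
theorem le_cross_chord_chord (hp : 2 < p) {a b a' b' c : ℝ} (ha : a ∈ Icc (0 : ℝ) 1)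
    (hb : b ∈ Icc (0 : ℝ) 1) (hab : a ≤ b) (ha' : a' ∈ Icc (0 : ℝ) 1) (hb' : b' ∈ Icc (0 : ℝ) 1)
    (hab' : a' ≤ b') (hc : ∀ u ∈ Icc a b, ∀ v ∈ Icc a' b',
      c ≤ Real.sin (Real.pi * (cantorLebesgue p v - cantorLebesgue p u))) :
    c * (b - a) * (b' - a') ≤ cross (curve p b - curve p a) (curve p b' - curve p a') := by
  refine le_cross_curve_sub hp ha' hb' hab' fun v hv => ?_
  rw [cross_swap]
  have := cross_curve_sub_le hp (z := tangent p v) (c := -c) ha hb hab fun u hu => by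
    rw [cross_swap, cross_tangent]
    linarith [hc u hu v hv]
  linarith

theorem cross_chord_chord_le (hp : 2 < p) {a b a' b' c : ℝ} (ha : a ∈ Icc (0 : ℝ) 1)
    (hb : b ∈ Icc (0 : ℝ) 1) (hab : a ≤ b) (ha' : a' ∈ Icc (0 : ℝ) 1) (hb' : b' ∈ Icc (0 : ℝ) 1)
    (hab' : a' ≤ b') (hc : ∀ u ∈ Icc a b, ∀ v ∈ Icc a' b',
      Real.sin (Real.pi * (cantorLebesgue p v - cantorLebesgue p u)) ≤ c) :
    cross (curve p b - curve p a) (curve p b' - curve p a') ≤ c * (b - a) * (b' - a') := by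
  refine cross_curve_sub_le hp ha' hb' hab' fun v hv => ?_
  rw [cross_swap]
  have := le_cross_curve_sub hp (z := tangent p v) (c := -c) ha hb hab fun u hu => by
    rw [cross_swap, cross_tangent]
    linarith [hc u hu v hv]
  linarith

theorem sin_pi_mul_sub_nonneg (hp : 2 < p) {u v : ℝ} (hu : u ∈ Icc (0 : ℝ) 1)
    (hv : v ∈ Icc (0 : ℝ) 1) (huv : u ≤ v) :
    0 ≤ Real.sin (Real.pi * (cantorLebesgue p v - cantorLebesgue p u)) := by
  have h1 := cantorLebesgue_monotoneOn hp hu hv huv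
  have h2 := (cantorLebesgue_mem hp hu).1
  have h3 := (cantorLebesgue_mem hp hv).2
  refine Real.sin_nonneg_of_nonneg_of_le_pi (mul_nonneg Real.pi_nonneg (by linarith)) ?_
  exact mul_le_of_le_one_right Real.pi_nonneg (by linarith)

theorem cross_chord_chord_nonneg (hp : 2 < p) {a b a' b' : ℝ} (ha : 0 ≤ a) (hab : a ≤ b)
    (hba' : b ≤ a') (hab' : a' ≤ b') (hb' : b' ≤ 1) :
    0 ≤ cross (curve p b - curve p a) (curve p b' - curve p a') := by
  have := le_cross_chord_chord hp (c := 0) (a := a) (b := b) (a' := a') (b' := b')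
    ⟨by linarith, by linarith⟩ ⟨by linarith, by linarith⟩ hab
    ⟨by linarith, by linarith⟩ ⟨by linarith, by linarith⟩ hab' fun u hu v hv =>
      sin_pi_mul_sub_nonneg hp ⟨by linarith [hu.1], by linarith [hu.2]⟩
        ⟨by linarith [hv.1], by linarith [hv.2]⟩ (by linarith [hu.2, hv.1])
  simpa using this

theorem cross_tangent_chord_nonneg (hp : 2 < p) {s a b : ℝ} (hs : 0 ≤ s) (hsa : s ≤ a)
    (hab : a ≤ b) (hb : b ≤ 1) : 0 ≤ cross (tangent p s) (curve p b - curve p a) := by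
  have := le_cross_curve_sub hp (z := tangent p s) (c := 0) (s := a) (t := b)
    ⟨by linarith, by linarith⟩ ⟨by linarith, by linarith⟩ hab fun u hu => by
      rw [cross_tangent]
      exact sin_pi_mul_sub_nonneg hp ⟨hs, by linarith⟩ ⟨by linarith [hu.1], by linarith [hu.2]⟩
        (by linarith [hu.1])
  simpa using this

theorem cross_chord_tangent_nonneg (hp : 2 < p) {s a b : ℝ} (ha : 0 ≤ a) (hab : a ≤ b)
    (hbs : b ≤ s) (hs : s ≤ 1) : 0 ≤ cross (curve p b - curve p a) (tangent p s) := by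
  rw [cross_swap]
  have := cross_curve_sub_le hp (z := tangent p s) (c := 0) (s := a) (t := b)
    ⟨by linarith, by linarith⟩ ⟨by linarith, by linarith⟩ hab fun u hu => by
      rw [cross_swap, cross_tangent]
      have := sin_pi_mul_sub_nonneg hp (u := u) (v := s) ⟨by linarith [hu.1], by linarith [hu.2]⟩
        ⟨by linarith, hs⟩ (by linarith [hu.2])
      linarith
  linarith

/-! ### The boundary of the Cantor-Lebesgue domain -/

/-- The centre of symmetry of the domain. -/
def center (p : ℝ) : ℂ :=
  (curve p 0 + curve p 1) / 2

/-- The position vector of the curve relative to the centre of symmetry. -/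
def radius (p t : ℝ) : ℂ :=
  curve p t - center p

theorem radius_sub (s t : ℝ) : radius p t - radius p s = curve p t - curve p s := by
  simp [radius]

theorem radius_one : radius p 1 = -radius p 0 := by
  simp only [radius, center]; ring

theorem boundaryCurve_eq : boundaryCurve p =
    {z | ∃ t ∈ Icc (0 : ℝ) 1, z = center p + radius p t ∨ z = center p - radius p t} := by
  ext z
  simp only [boundaryCurve, mem_union, mem_image, mem_ofPred_eq, radius, center]
  constructor
  · rintro (⟨t, ht, rfl⟩ | ⟨_, ⟨t, ht, rfl⟩, rfl⟩)
    · exact ⟨t, ht, Or.inl (by ring)⟩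
    · exact ⟨t, ht, Or.inr (by ring)⟩
  · rintro ⟨t, ht, rfl | rfl⟩
    · exact Or.inl ⟨t, ht, by ring⟩
    · exact Or.inr ⟨_, ⟨t, ht, rfl⟩, by ring⟩

theorem continuousOn_curve (hp : 2 < p) : ContinuousOn (curve p) (Icc 0 1) := by
  have : LipschitzOnWith 1 (curve p) (Icc 0 1) :=
    LipschitzOnWith.of_dist_le_mul fun s hs t ht => by
      rw [dist_eq_norm, Real.dist_eq, NNReal.coe_one, one_mul]
      exact norm_curve_sub_le hp ht hs
  exact this.continuousOn

theorem isCompact_boundaryCurve (hp : 2 < p) : IsCompact (boundaryCurve p) := by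
  have h := isCompact_Icc.image_of_continuousOn (continuousOn_curve hp)
  exact h.union (h.image (by fun_prop))

theorem curve_mem_hull {t : ℝ} (ht : t ∈ Icc (0 : ℝ) 1) :
    curve p t ∈ convexHull ℝ (boundaryCurve p) :=
  subset_convexHull _ _ (Or.inl (mem_image_of_mem _ ht))

theorem isOpen_domain : IsOpen (domain p) := isOpen_interior

theorem convex_domain : Convex ℝ (domain p) := (convex_convexHull ℝ _).interior

theorem isBounded_domain (hp : 2 < p) : Bornology.IsBounded (domain p) :=
  (isBounded_convexHull.2 (isCompact_boundaryCurve hp).isBounded).subset interior_subset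

/-- The line that is tangent to the curve at time `t` supports the convex hull. -/
theorem cross_tangent_nonneg (hp : 2 < p) {t : ℝ} (ht : t ∈ Icc (0 : ℝ) 1) {z : ℂ}
    (hz : z ∈ convexHull ℝ (boundaryCurve p)) : 0 ≤ cross (tangent p t) (z - curve p t) := by
  suffices h : boundaryCurve p ⊆ {z | 0 ≤ cross (tangent p t) (z - curve p t)} from
    convexHull_min h (convex_setOf_cross_nonneg _ _) hz
  rintro _ (⟨s, hs, rfl⟩ | ⟨_, ⟨s, hs, rfl⟩, rfl⟩)
  · rw [mem_ofPred_eq]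
    rcases le_total t s with h | h
    · exact cross_tangent_chord_nonneg hp ht.1 le_rfl h hs.2
    · have := cross_chord_tangent_nonneg hp hs.1 h le_rfl ht.2
      rw [← neg_sub, cross_neg_right, ← cross_swap]
      exact this
  · rw [mem_ofPred_eq]
    have key : ∀ a b : ℝ, 0 ≤ a → a ≤ t → t ≤ b → b ≤ 1 →
        curve p 0 + curve p 1 - curve p s - curve p t =
          (curve p 1 - curve p b) - (curve p a - curve p 0) →
        0 ≤ cross (tangent p t) (curve p 0 + curve p 1 - curve p s - curve p t) := by
      intro a b ha hat htb hb e
      rw [e, cross_sub_right, cross_swap _ (curve p a - curve p 0), sub_neg_eq_add]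
      exact add_nonneg (cross_tangent_chord_nonneg hp ht.1 htb hb le_rfl)
        (cross_chord_tangent_nonneg hp le_rfl ha hat ht.2)
    rcases le_total t s with h | h
    · exact key t s ht.1 le_rfl h hs.2 (by ring)
    · exact key s t hs.1 h le_rfl ht.2 (by ring)

theorem reflect_mem_hull {z : ℂ} (hz : z ∈ convexHull ℝ (boundaryCurve p)) :
    curve p 0 + curve p 1 - z ∈ convexHull ℝ (boundaryCurve p) := by
  have hc : Convex ℝ ((fun z => curve p 0 + curve p 1 - z) ⁻¹' convexHull ℝ (boundaryCurve p)) := by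
    intro x hx y hy s t hs ht hst
    have := convex_convexHull ℝ (boundaryCurve p) hx hy hs ht hst
    rw [mem_preimage]
    convert this using 1
    simp only [smul_sub]
    have h : s • (curve p 0 + curve p 1) + t • (curve p 0 + curve p 1) = curve p 0 + curve p 1 := by
      rw [← add_smul, hst, one_smul]
    linear_combination (exp := 1) -h
  refine convexHull_min ?_ hc hz
  rintro _ (⟨s, hs, rfl⟩ | ⟨_, ⟨s, hs, rfl⟩, rfl⟩)
  · exact subset_convexHull _ _ (Or.inr ⟨_, mem_image_of_mem _ hs, rfl⟩)
  · refine subset_convexHull _ _ (Or.inl ⟨s, hs, ?_⟩)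
    simp

theorem reflect_mem_domain {z : ℂ} (hz : z ∈ domain p) :
    curve p 0 + curve p 1 - z ∈ domain p := by
  have := (Homeomorph.subLeft (curve p 0 + curve p 1)).preimage_interior
    (convexHull ℝ (boundaryCurve p))
  have h : z ∈ interior ((Homeomorph.subLeft (curve p 0 + curve p 1)) ⁻¹'
      convexHull ℝ (boundaryCurve p)) :=
    interior_mono (fun w hw => reflect_mem_hull hw) hz
  rw [← this] at h
  exact h

/-- The two ends of an increasing interval of stage `n` and the left end of its central piece
span a triangle whose area is bounded from below. -/
theorem le_cross_arc_triangle (hp : 2 < p) {n k : ℕ} (hk : k < 2 ^ n) :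
    (1 - 2 / p) / p ^ 2 * (1 / p ^ n) ^ 2 * Real.sin (Real.pi / 2 ^ n / 4) ≤
      cross (curve p (arcLeft p n k + 1 / p / p ^ n) - curve p (arcLeft p n k))
        (curve p (arcRight p n k) - curve p (arcLeft p n k)) := by
  have hp0 : 0 < p := by linarith
  have h1p : 1 / p < 1 / 2 := one_div_lt_one_div_of_lt two_pos hp
  have h1p0 : 0 < 1 / p := by positivity
  have h1pp : 1 / p / p ≤ 1 / p := div_le_self h1p0.le (by linarith)
  have h1pp0 : 0 < 1 / p / p := by positivity
  have hpn : 0 < p ^ n := by positivity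
  have i1 : 1 / p ∈ Icc (0 : ℝ) 1 := ⟨by linarith, by linarith⟩
  have i2 : 1 / p / p ∈ Icc (0 : ℝ) 1 := ⟨by linarith, by linarith⟩
  have i3 : 1 - 1 / p ∈ Icc (0 : ℝ) 1 := ⟨by linarith, by linarith⟩
  have v1 : cantorLebesgue p (1 / p) = 1 / 2 := by
    rw [cantorLebesgue_left hp (by simp), cantorLebesgue_one hp]
  have v2 : cantorLebesgue p (1 / p / p) = 1 / 4 := by
    rw [cantorLebesgue_left hp i1, v1]; norm_num
  have v3 : cantorLebesgue p (1 - 1 / p) = 1 / 2 := by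
    have := cantorLebesgue_right hp (x := 0) (by simp)
    rwa [zero_div, add_zero, cantorLebesgue_zero hp, zero_div, add_zero] at this
  obtain ⟨m1, f1⟩ := arcLeft_add_mem hp n k hk _ i1
  obtain ⟨m2, f2⟩ := arcLeft_add_mem hp n k hk _ i2
  obtain ⟨m3, f3⟩ := arcLeft_add_mem hp n k hk _ i3
  have ml := arcLeft_mem hp hk
  have mr := arcRight_mem hp hk
  have fl := cantorLebesgue_arcLeft hp hk
  rw [v1] at f1
  rw [v2] at f2
  rw [v3] at f3
  have o1 : arcLeft p n k ≤ arcLeft p n k + 1 / p / p / p ^ n := by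
    linarith [div_pos h1pp0 hpn]
  have o2 : arcLeft p n k + 1 / p / p / p ^ n ≤ arcLeft p n k + 1 / p / p ^ n := by gcongr
  have o3 : arcLeft p n k + 1 / p / p ^ n ≤ arcLeft p n k + (1 - 1 / p) / p ^ n := by
    gcongr; linarith
  have o4 : arcLeft p n k + (1 - 1 / p) / p ^ n ≤ arcRight p n k := by
    rw [arcRight]; gcongr; linarith
  set l := arcLeft p n k
  set r := arcRight p n k
  set a := l + 1 / p / p / p ^ n with hadef
  set b := l + 1 / p / p ^ n with hbdef
  set c := l + (1 - 1 / p) / p ^ n with hcdef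
  have key := le_cross_chord_chord hp (c := Real.sin (Real.pi / 2 ^ n / 4)) ml m2 o1 m1 m3 o3
    fun u hu v hv => by
      have hu' : u ∈ Icc (0 : ℝ) 1 := ⟨ml.1.trans hu.1, hu.2.trans m2.2⟩
      have hv' : v ∈ Icc (0 : ℝ) 1 := ⟨m1.1.trans hv.1, hv.2.trans m3.2⟩
      have g1 := cantorLebesgue_monotoneOn hp ml hu' hu.1
      have g2 := cantorLebesgue_monotoneOn hp hu' m2 hu.2
      have g3 := cantorLebesgue_monotoneOn hp m1 hv' hv.1
      have g4 := cantorLebesgue_monotoneOn hp hv' m3 hv.2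
      rw [f1] at g3
      rw [f2] at g2
      rw [f3] at g4
      rw [fl] at g1
      have e1 : ((k : ℝ) + 1 / 2) / 2 ^ n - (k + 1 / 4) / 2 ^ n = 1 / 2 ^ n / 4 := by ring
      have e2 : ((k : ℝ) + 1 / 2) / 2 ^ n - k / 2 ^ n = 1 / 2 ^ n / 2 := by ring
      have e3 : 1 / (2 : ℝ) ^ n ≤ 1 := by
        rw [div_le_one (by positivity)]; exact one_le_pow₀ (by norm_num)
      have e4 : 0 < 1 / (2 : ℝ) ^ n := by positivity
      have b1 : 1 / 2 ^ n / 4 ≤ cantorLebesgue p v - cantorLebesgue p u := by linarith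
      have b2 : cantorLebesgue p v - cantorLebesgue p u ≤ 1 / 2 := by linarith
      have b3 := mul_le_mul_of_nonneg_left b1 Real.pi_nonneg
      have b4 := mul_le_mul_of_nonneg_left b2 Real.pi_nonneg
      have b5 : Real.pi * (1 / 2 ^ n / 4) = Real.pi / 2 ^ n / 4 := by ring
      have b6 : 0 < Real.pi / 2 ^ n / 4 := by positivity
      exact Real.sin_le_sin_of_le_of_le_pi_div_two (by linarith) (by linarith) (by linarith)
  have n1 := cross_chord_chord_nonneg hp ml.1 o1 (o2.trans o3) o4 mr.2
  have n2 := cross_chord_chord_nonneg hp m2.1 o2 le_rfl o3 m3.2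
  have n3 := cross_chord_chord_nonneg hp m2.1 o2 o3 o4 mr.2
  have split : cross (curve p b - curve p l) (curve p r - curve p l) =
      cross (curve p a - curve p l) (curve p c - curve p b) +
      cross (curve p a - curve p l) (curve p r - curve p c) +
      cross (curve p b - curve p a) (curve p c - curve p b) +
      cross (curve p b - curve p a) (curve p r - curve p c) := by
    simp only [cross, Complex.sub_re, Complex.sub_im]; ring
  have e : (1 - 2 / p) / p ^ 2 * (1 / p ^ n) ^ 2 * Real.sin (Real.pi / 2 ^ n / 4) =
      Real.sin (Real.pi / 2 ^ n / 4) * (a - l) * (c - b) := by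
    simp only [hadef, hbdef, hcdef]
    field_simp
    ring
  rw [e, split]
  linarith

theorem nonempty_domain (hp : 2 < p) : (domain p).Nonempty := by
  have hp0 : 0 < p := by linarith
  have h1p : 1 / p < 1 / 2 := one_div_lt_one_div_of_lt two_pos hp
  have h1p0 : 0 < 1 / p := by positivity
  have h2p : 0 < 1 - 2 / p := by
    have : 2 / p = 2 * (1 / p) := by ring
    linarith
  have h := le_cross_arc_triangle hp (n := 0) (k := 0) (by simp)
  simp only [arcRight, arcLeft, pow_zero, div_one, zero_add] at h
  have hD : 0 < cross (curve p (1 / p) - curve p 0) (curve p 1 - curve p 0) := by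
    refine lt_of_lt_of_le ?_ h
    have : 0 < Real.sin (Real.pi / 4) :=
      Real.sin_pos_of_pos_of_lt_pi (by positivity) (by linarith [Real.pi_pos])
    positivity
  have i0 : (0 : ℝ) ∈ Icc (0 : ℝ) 1 := by simp
  have i1 : 1 / p ∈ Icc (0 : ℝ) 1 := ⟨by linarith, by linarith⟩
  have i2 : (1 : ℝ) ∈ Icc (0 : ℝ) 1 := by simp
  have l1 := norm_curve_sub_le hp i0 i1
  have l2 := norm_curve_sub_le hp i0 i2
  rw [sub_zero, abs_of_pos h1p0] at l1
  rw [sub_zero, abs_one] at l2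
  have := ball_subset_of_triangle (convex_convexHull ℝ (boundaryCurve p)) (curve_mem_hull i0)
    (curve_mem_hull i1) (curve_mem_hull i2) one_pos (by linarith) l2
    (ρ := cross (curve p (1 / p) - curve p 0) (curve p 1 - curve p 0) / 8) (by positivity)
    (by linarith) (x := 1 / 4) (x' := 1 / 4) (by norm_num) (by norm_num) (by norm_num)
  exact ⟨_, interior_maximal this Metric.isOpen_ball (Metric.mem_ball_self (by positivity))⟩

theorem center_mem_domain (hp : 2 < p) : center p ∈ domain p := by
  obtain ⟨z, hz⟩ := nonempty_domain hp
  have := convex_domain hz (reflect_mem_domain hz) (a := 1 / 2) (b := 1 / 2) (by norm_num)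
    (by norm_num) (by norm_num)
  convert this using 1
  rw [← smul_add, center, Complex.real_smul]
  push_cast
  ring

/-- The support lines stay at a positive distance from the centre. -/
theorem exists_le_cross_radius_tangent (hp : 2 < p) :
    ∃ r : ℝ, 0 < r ∧ ∀ t ∈ Icc (0 : ℝ) 1, r ≤ cross (radius p t) (tangent p t) := by
  obtain ⟨r, hr, hball⟩ := Metric.isOpen_iff.1 isOpen_domain _ (center_mem_domain hp)
  refine ⟨r / 2, by positivity, fun t ht => ?_⟩
  have hn : ‖(r / 2) • (Complex.I * tangent p t)‖ = r / 2 := by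
    rw [norm_smul, norm_mul, Complex.norm_I, norm_tangent, Real.norm_of_nonneg (by positivity)]
    ring
  have hmem : center p - (r / 2) • (Complex.I * tangent p t) ∈ domain p := by
    apply hball
    rw [Metric.mem_ball, dist_eq_norm, sub_sub_cancel_left, norm_neg, hn]
    linarith
  have h := cross_tangent_nonneg hp ht (interior_subset hmem)
  have e : center p - (r / 2) • (Complex.I * tangent p t) - curve p t =
      -(r / 2) • (Complex.I * tangent p t) - radius p t := by
    simp only [radius, neg_smul]; ring
  have e2 : cross (tangent p t) (Complex.I * tangent p t) = 1 := by
    have := norm_tangent (p := p) t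
    rw [← sq_eq_sq₀ (norm_nonneg _) zero_le_one, ← Complex.normSq_eq_norm_sq,
      Complex.normSq_apply] at this
    simp only [cross, Complex.mul_re, Complex.mul_im, Complex.I_re, Complex.I_im]
    linarith
  rw [e, cross_sub_right, cross_smul_right, e2, cross_swap _ (radius p t)] at h
  linarith

theorem radius_ne_zero (hp : 2 < p) {t : ℝ} (ht : t ∈ Icc (0 : ℝ) 1) : radius p t ≠ 0 := by
  obtain ⟨r, hr, h⟩ := exists_le_cross_radius_tangent hp
  intro h0
  have := h t ht
  simp [h0, cross] at this
  linarith

/-- Every ray from the centre meets the closed curve: a line through the centre separates the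
two ends of the half-curve, so it meets it. -/
theorem exists_eq_center_add_smul_radius (hp : 2 < p) (z : ℂ) :
    ∃ t ∈ Icc (0 : ℝ) 1, ∃ s : ℝ, 0 ≤ s ∧
      (z = center p + s • radius p t ∨ z = center p - s • radius p t) := by
  have hcont : ContinuousOn (fun t => cross (z - center p) (radius p t)) (Icc 0 1) :=
    (continuous_cross_right _).comp_continuousOn ((continuousOn_curve hp).sub continuousOn_const)
  have hmem : (0 : ℝ) ∈ uIcc (cross (z - center p) (radius p 0))
      (cross (z - center p) (radius p 1)) := by
    rw [radius_one, cross_neg_right, mem_uIcc]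
    rcases le_total 0 (cross (z - center p) (radius p 0)) with h | h
    · right; exact ⟨by linarith, h⟩
    · left; exact ⟨h, by linarith⟩
  rw [← uIcc_of_le (zero_le_one (α := ℝ))] at hcont
  obtain ⟨t, ht, h0⟩ := intermediate_value_uIcc hcont hmem
  rw [uIcc_of_le zero_le_one] at ht
  obtain ⟨c, hc⟩ := eq_smul_of_cross_eq_zero (radius_ne_zero hp ht) h0
  refine ⟨t, ht, |c|, abs_nonneg c, ?_⟩
  rw [sub_eq_iff_eq_add'] at hc
  rcases le_total 0 c with h | h
  · left; rw [abs_of_nonneg h, hc]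
  · right; rw [abs_of_nonpos h, hc, neg_smul, sub_neg_eq_add]

theorem curve_notMem_domain (hp : 2 < p) {t : ℝ} (ht : t ∈ Icc (0 : ℝ) 1) :
    curve p t ∉ domain p := by
  intro h
  obtain ⟨r, hr, hball⟩ := Metric.isOpen_iff.1 isOpen_domain _ h
  obtain ⟨r', hr', hr''⟩ := exists_le_cross_radius_tangent hp
  -- Leaving the curve radially outwards crosses the support line.
  have hn : 0 < ‖radius p t‖ := norm_pos_iff.2 (radius_ne_zero hp ht)
  have hmem : curve p t + (r / 2 / ‖radius p t‖) • radius p t ∈ domain p := by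
    apply hball
    rw [Metric.mem_ball, dist_eq_norm, add_sub_cancel_left, norm_smul,
      Real.norm_of_nonneg (by positivity), div_mul_cancel₀ _ hn.ne']
    linarith
  have h1 := cross_tangent_nonneg hp ht (interior_subset hmem)
  rw [add_sub_cancel_left, cross_smul_right, cross_swap] at h1
  have h2 : 0 < r / 2 / ‖radius p t‖ * cross (radius p t) (tangent p t) :=
    mul_pos (by positivity) (lt_of_lt_of_le hr' (hr'' t ht))
  linarith

theorem notMem_domain_of_mem_boundaryCurve (hp : 2 < p) {z : ℂ} (hz : z ∈ boundaryCurve p) :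
    z ∉ domain p := by
  rcases hz with ⟨t, ht, rfl⟩ | ⟨_, ⟨t, ht, rfl⟩, rfl⟩
  · exact curve_notMem_domain hp ht
  · intro h
    have := reflect_mem_domain h
    rw [sub_sub_cancel] at this
    exact curve_notMem_domain hp ht this

theorem closure_domain (hp : 2 < p) :
    closure (domain p) = closure (convexHull ℝ (boundaryCurve p)) :=
  (convex_convexHull ℝ _).closure_interior_eq_closure_of_nonempty_interior (nonempty_domain hp)

theorem center_add_smul_mem_domain (hp : 2 < p) {w : ℂ}
    (hw : center p + w ∈ closure (convexHull ℝ (boundaryCurve p))) {s : ℝ} (hs : 0 ≤ s)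
    (hs1 : s < 1) :
    center p + s • w ∈ domain p := by
  rcases hs.eq_or_lt with rfl | hs
  · simpa using center_mem_domain hp
  · refine (convex_convexHull ℝ (boundaryCurve p)).openSegment_interior_closure_subset_interior
      (center_mem_domain hp) hw ⟨1 - s, s, by linarith, hs, by ring, ?_⟩
    module

theorem frontier_domain (hp : 2 < p) : frontier (domain p) = boundaryCurve p := by
  apply Subset.antisymm
  · intro z hz
    rw [isOpen_domain.frontier_eq, closure_domain hp] at hz
    obtain ⟨hzK, hzΩ⟩ := hz
    obtain ⟨t, ht, s, hs, hzs⟩ := exists_eq_center_add_smul_radius hp z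
    obtain ⟨w, hw, rfl⟩ : ∃ w, center p + w ∈ boundaryCurve p ∧ z = center p + s • w := by
      rw [boundaryCurve_eq]
      rcases hzs with rfl | rfl
      · exact ⟨radius p t, ⟨t, ht, Or.inl rfl⟩, rfl⟩
      · exact ⟨-radius p t, ⟨t, ht, Or.inr (by ring)⟩, by module⟩
    rcases lt_trichotomy s 1 with h | rfl | h
    · exact absurd
        (center_add_smul_mem_domain hp (subset_closure (subset_convexHull _ _ hw)) hs h) hzΩ
    · simpa using hw
    · have := center_add_smul_mem_domain hp hzK (s := s⁻¹) (by positivity) (inv_lt_one_of_one_lt₀ h)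
      rw [smul_smul, inv_mul_cancel₀ (by linarith), one_smul] at this
      exact absurd this (notMem_domain_of_mem_boundaryCurve hp hw)
  · intro z hz
    rw [isOpen_domain.frontier_eq, closure_domain hp]
    exact ⟨subset_closure (subset_convexHull _ _ hz), notMem_domain_of_mem_boundaryCurve hp hz⟩

/-! ### Areas in linear coordinates -/

/-- The linear map that sends `1` to `u` and `i` to `v`. -/
def planeMap (u v : ℂ) : ℂ →L[ℝ] ℂ :=
  Complex.reCLM.smulRight u + Complex.imCLM.smulRight v

theorem planeMap_apply (u v z : ℂ) : planeMap u v z = z.re • u + z.im • v := by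
  simp [planeMap]

theorem det_planeMap (u v : ℂ) : (planeMap u v).det = cross u v := by
  rw [ContinuousLinearMap.det, ← LinearMap.det_toMatrix Complex.basisOneI, Matrix.det_fin_two]
  simp [LinearMap.toMatrix_apply, planeMap_apply, cross]
  ring

theorem injective_planeMap {u v : ℂ} (h : cross u v ≠ 0) : Function.Injective (planeMap u v) := by
  intro z w hzw
  simp only [planeMap_apply] at hzw
  have h1 := congrArg (fun y => cross y v) hzw
  have h2 := congrArg (fun y => cross u y) hzw
  simp only [cross_add_left, cross_add_right, cross_smul_left, cross_smul_right, cross_self,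
    mul_zero, add_zero, zero_add] at h1 h2
  exact Complex.ext (mul_right_cancel₀ h h1) (mul_right_cancel₀ h h2)

theorem volume_reProdIm (s t : Set ℝ) : volume (s ×ℂ t) = volume s * volume t := by
  have : s ×ℂ t = Complex.measurableEquivRealProd ⁻¹' (s ×ˢ t) := by
    ext z; simp [Complex.mem_reProdIm]
  rw [this, Complex.volume_preserving_equiv_real_prod.measure_preimage_equiv,
    Measure.volume_eq_prod, Measure.prod_prod]

theorem volume_planeMap_image (u v : ℂ) (s : Set ℂ) :
    volume (planeMap u v '' s) = ENNReal.ofReal |cross u v| * volume s := by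
  rw [Measure.addHaar_image_continuousLinearMap, ← det_planeMap]

theorem lintegral_planeMap_image {u v : ℂ} (c : ℂ) (h : cross u v ≠ 0) {s : Set ℂ}
    (hs : MeasurableSet s) (g : ℂ → ENNReal) :
    ∫⁻ y in (fun z => c + planeMap u v z) '' s, g y =
      ENNReal.ofReal |cross u v| * ∫⁻ z in s, g (c + planeMap u v z) := by
  rw [lintegral_image_eq_lintegral_abs_det_fderiv_mul volume hs
    (fun z _ => ((planeMap u v).hasFDerivAt.const_add c).hasFDerivWithinAt)
    (fun z _ w _ hzw => injective_planeMap h (add_left_cancel hzw)), det_planeMap,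
    lintegral_const_mul' _ _ ENNReal.ofReal_ne_top]

theorem lintegral_reProdIm_mul {f g : ℝ → ENNReal} (hf : Measurable f) (hg : Measurable g)
    {s t : Set ℝ} (hs : MeasurableSet s) (ht : MeasurableSet t) :
    ∫⁻ z in s ×ℂ t, f z.re * g z.im = (∫⁻ a in s, f a) * ∫⁻ b in t, g b := by
  have e : s ×ℂ t = Complex.measurableEquivRealProd ⁻¹' (s ×ˢ t) := by
    ext z; simp [Complex.mem_reProdIm]
  rw [e]
  have := Complex.volume_preserving_equiv_real_prod.setLIntegral_comp_preimage (hs.prod ht)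
    (f := fun q : ℝ × ℝ => f q.1 * g q.2) (by fun_prop)
  simp only [Complex.measurableEquivRealProd_apply] at this
  rw [this, Measure.volume_eq_prod, ← Measure.prod_restrict,
    lintegral_prod_mul hf.aemeasurable hg.aemeasurable]

/-- The shift by `η` in the second factor keeps the integral finite at the price of a second
logarithm. -/
theorem lintegral_inv_mul_inv {η : ℝ} (h0 : 0 < η) (h1 : η ≤ 1) :
    ∫⁻ z in Icc η 1 ×ℂ Icc 0 1, ENNReal.ofReal (1 / z.re) * ENNReal.ofReal (1 / (z.im + η)) ≤
      ENNReal.ofReal ((Real.log (1 / η) + 1) ^ 2) := by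
  have hlog : 0 ≤ Real.log (1 / η) := Real.log_nonneg ((one_le_div h0).2 h1)
  have i1 : ∫⁻ a in Icc η 1, ENNReal.ofReal (1 / a) = ENNReal.ofReal (Real.log (1 / η)) := by
    have hc : ContinuousOn (fun a : ℝ => 1 / a) (Icc η 1) :=
      continuousOn_const.div continuousOn_id fun a ha => (h0.trans_le ha.1).ne'
    rw [← ofReal_integral_eq_lintegral_ofReal hc.integrableOn_Icc, integral_Icc_eq_integral_Ioc,
      ← intervalIntegral.integral_of_le h1, integral_one_div_of_pos h0 one_pos]
    filter_upwards [ae_restrict_mem measurableSet_Icc] with a ha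
    exact div_nonneg zero_le_one (h0.le.trans ha.1)
  have i2 : ∫⁻ a in Icc (0 : ℝ) 1, ENNReal.ofReal (1 / (a + η)) =
      ENNReal.ofReal (Real.log ((1 + η) / η)) := by
    have hc : ContinuousOn (fun a : ℝ => 1 / (a + η)) (Icc 0 1) :=
      continuousOn_const.div (by fun_prop) fun a ha => by have := ha.1; positivity
    rw [← ofReal_integral_eq_lintegral_ofReal hc.integrableOn_Icc, integral_Icc_eq_integral_Ioc,
      ← intervalIntegral.integral_of_le zero_le_one,
      intervalIntegral.integral_comp_add_right (fun a => 1 / a), zero_add,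
      integral_one_div_of_pos h0 (by linarith)]
    filter_upwards [ae_restrict_mem measurableSet_Icc] with a ha
    have := ha.1
    positivity
  have h2 : Real.log ((1 + η) / η) ≤ Real.log (1 / η) + 1 := by
    have : (1 + η) / η = 1 / η * (1 + η) := by ring
    rw [this, Real.log_mul (by positivity) (by positivity)]
    linarith [Real.log_le_sub_one_of_pos (show 0 < 1 + η by linarith)]
  rw [lintegral_reProdIm_mul (f := fun a => ENNReal.ofReal (1 / a))
    (g := fun a => ENNReal.ofReal (1 / (a + η))) (by fun_prop) (by fun_prop) measurableSet_Icc
    measurableSet_Icc, i1, i2, ← ENNReal.ofReal_mul hlog]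
  apply ENNReal.ofReal_le_ofReal
  rw [sq]
  apply mul_le_mul <;> first | linarith | skip
  exact Real.log_nonneg ((one_le_div h0).2 (by linarith))

/-! ### The upper bound -/

/-- The rhombus with vertices `center p ± u` and `center p ± v` is contained in the domain. -/
theorem rhombus_subset_domain (hp : 2 < p) {u v : ℂ} (hu : center p + u ∈ boundaryCurve p)
    (hu' : center p - u ∈ boundaryCurve p) (hv : center p + v ∈ boundaryCurve p)
    (hv' : center p - v ∈ boundaryCurve p) {a b : ℝ} (hab : |a| + |b| < 1) :
    center p + (a • u + b • v) ∈ domain p := by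
  have hK := convex_convexHull ℝ (boundaryCurve p)
  have key : ∀ (w : ℂ) (t : ℝ), center p + w ∈ boundaryCurve p → center p - w ∈ boundaryCurve p →
      ∃ w' : ℂ, center p + w' ∈ convexHull ℝ (boundaryCurve p) ∧ t • w = |t| • w' := by
    intro w t h h'
    rcases le_total 0 t with ht | ht
    · exact ⟨w, subset_convexHull _ _ h, by rw [abs_of_nonneg ht]⟩
    · exact ⟨-w, subset_convexHull _ _ (by rwa [← sub_eq_add_neg]), by
        rw [abs_of_nonpos ht, smul_neg, neg_smul, neg_neg]⟩
  obtain ⟨u', hu1, hu2⟩ := key u a hu hu'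
  obtain ⟨v', hv1, hv2⟩ := key v b hv hv'
  rw [hu2, hv2]
  have hs0 : 0 ≤ |a| + |b| := by positivity
  rcases hs0.eq_or_lt with h0 | h0
  · have ha : |a| = 0 := by linarith [abs_nonneg a, abs_nonneg b]
    have hb : |b| = 0 := by linarith [abs_nonneg a, abs_nonneg b]
    rw [ha, hb]
    simpa using center_mem_domain hp
  · have h1 : center p + ((|a| / (|a| + |b|)) • u' + (|b| / (|a| + |b|)) • v') ∈
        convexHull ℝ (boundaryCurve p) := by
      have hsum : |a| / (|a| + |b|) + |b| / (|a| + |b|) = 1 := by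
        rw [← add_div, div_self h0.ne']
      have := hK hu1 hv1 (a := |a| / (|a| + |b|)) (b := |b| / (|a| + |b|)) (by positivity)
        (by positivity) hsum
      convert this using 1
      rw [smul_add, smul_add, add_add_add_comm, ← add_smul, hsum, one_smul]
    have := center_add_smul_mem_domain hp (subset_closure h1) hs0 hab
    rw [smul_add, smul_smul, smul_smul, mul_div_cancel₀ _ h0.ne', mul_div_cancel₀ _ h0.ne'] at this
    exact this

/-- In the sector spanned by `u` and `v`, the density is bounded by that of the rhombus of
`rhombus_subset_domain`, in which a parallelogram centred at the point is explicit. -/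
theorem busemann_le_of_rhombus (hp : 2 < p) {u v : ℂ} (hu : center p + u ∈ boundaryCurve p)
    (hu' : center p - u ∈ boundaryCurve p) (hv : center p + v ∈ boundaryCurve p)
    (hv' : center p - v ∈ boundaryCurve p) (hD : cross u v ≠ 0) {m w : ℝ} (hm : 0 ≤ m)
    (hw : 0 < w) (hmw : 2 * m + w ≤ 1) :
    busemann (domain p) (center p + (m • u + (1 - w - m) • v)) ≤
      ENNReal.ofReal (2 * Real.pi / |cross u v| * (1 / w) * (1 / (m + w))) := by
  have hD' : 0 < |cross u v| := abs_pos.2 hD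
  set S : Set ℂ := planeMap (u - v) u ''
    (Ioo (-(m + w / 4)) (m + w / 4) ×ℂ Ioo (-(w / 2)) (w / 2)) with hS
  have hmem : ∀ a b : ℝ, a ∈ Ioo (-(m + w / 4)) (m + w / 4) → b ∈ Ioo (-(w / 2)) (w / 2) →
      center p + (m • u + (1 - w - m) • v) + (a • (u - v) + b • u) ∈ domain p := by
    intro a b ha hb
    have : center p + (m • u + (1 - w - m) • v) + (a • (u - v) + b • u) =
        center p + ((m + a + b) • u + (1 - w - m - a) • v) := by module
    rw [this]
    apply rhombus_subset_domain hp hu hu' hv hv'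
    obtain ⟨a1, a2⟩ := ha
    obtain ⟨b1, b2⟩ := hb
    rcases abs_cases (m + a + b) with ⟨e, -⟩ | ⟨e, -⟩ <;>
    rcases abs_cases (1 - w - m - a) with ⟨e', -⟩ | ⟨e', -⟩ <;> rw [e, e'] <;> linarith
  have hy : center p + (m • u + (1 - w - m) • v) ∈ domain p := by
    have := hmem 0 0 ⟨by linarith, by linarith⟩ ⟨by linarith, by linarith⟩
    simpa using this
  have hle := busemann_le isOpen_domain convex_domain (isBounded_domain hp) hy (S := S) (by
    rintro _ ⟨z, ⟨hz1, hz2⟩, rfl⟩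
    rw [mem_preimage] at hz1 hz2
    rw [planeMap_apply]
    refine ⟨hmem _ _ hz1 hz2, ?_⟩
    have := hmem (-z.re) (-z.im) ⟨by linarith [hz1.2], by linarith [hz1.1]⟩
      ⟨by linarith [hz2.2], by linarith [hz2.1]⟩
    convert this using 1
    module)
  refine hle.trans ?_
  have hcross : |cross (u - v) u| = |cross u v| := by
    rw [cross_sub_left, cross_self, zero_sub, ← cross_swap]
  rw [hS, volume_planeMap_image, volume_reProdIm, Real.volume_Ioo, Real.volume_Ioo, hcross,
    ← ENNReal.ofReal_mul (by linarith), ← ENNReal.ofReal_mul hD'.le,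
    ← ENNReal.ofReal_div_of_pos (mul_pos hD' (mul_pos (by linarith) (by linarith)))]
  apply ENNReal.ofReal_le_ofReal
  have e : 2 * Real.pi / |cross u v| * (1 / w) * (1 / (m + w)) =
      Real.pi / (|cross u v| * ((m + w) / 2 * w)) := by
    field_simp
  rw [e]
  apply div_le_div_of_nonneg_left Real.pi_nonneg (by positivity)
  apply mul_le_mul_of_nonneg_left _ hD'.le
  apply mul_le_mul <;> linarith

theorem hilbertMeasure_half_sector_le (hp : 2 < p) {u v : ℂ}
    (hu : center p + u ∈ boundaryCurve p)
    (hu' : center p - u ∈ boundaryCurve p) (hv : center p + v ∈ boundaryCurve p)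
    (hv' : center p - v ∈ boundaryCurve p) (hD : cross u v ≠ 0) {η : ℝ} (h0 : 0 < η)
    (h1 : η ≤ 1) :
    hilbertMeasure (domain p) {y | ∃ a b : ℝ, 0 ≤ a ∧ a ≤ b ∧ a + b ≤ 1 - η ∧
      y = center p + (a • u + b • v)} ≤
      ENNReal.ofReal (2 * Real.pi * (Real.log (1 / η) + 1) ^ 2) := by
  have hD' : 0 < |cross u v| := abs_pos.2 hD
  set s : Set ℂ := {z | η ≤ z.re ∧ 0 ≤ z.im ∧ 2 * z.im + z.re ≤ 1} with hs
  have hsm : MeasurableSet s := by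
    change MeasurableSet ({z : ℂ | η ≤ z.re} ∩
      ({z : ℂ | 0 ≤ z.im} ∩ {z : ℂ | 2 * z.im + z.re ≤ 1}))
    exact (measurableSet_le measurable_const Complex.measurable_re).inter
      ((measurableSet_le measurable_const Complex.measurable_im).inter
        (measurableSet_le ((Complex.measurable_im.const_mul 2).add Complex.measurable_re)
          measurable_const))
  -- The coordinates are `w = 1 - a - b`, the depth below the chord, and `a`.
  set A : Set ℂ := (fun z => center p + v + planeMap (-v) (u - v) z) '' s with hA
  have heq : ∀ z : ℂ, center p + v + planeMap (-v) (u - v) z =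
      center p + (z.im • u + (1 - z.re - z.im) • v) := by
    intro z
    rw [planeMap_apply]
    module
  have hcross : |cross (-v) (u - v)| = |cross u v| := by
    rw [cross_neg_left, cross_sub_right, cross_self, sub_zero, ← cross_swap]
  have hAΩ : A ⊆ domain p := by
    rintro _ ⟨z, ⟨h1, h2, h3⟩, rfl⟩
    dsimp only
    rw [heq]
    apply rhombus_subset_domain hp hu hu' hv hv'
    rw [abs_of_nonneg h2, abs_of_nonneg (by linarith)]
    linarith
  calc _ ≤ hilbertMeasure (domain p) A := by
        apply measure_mono
        rintro _ ⟨a, b, ha, hab, habη, rfl⟩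
        refine ⟨⟨1 - a - b, a⟩, ⟨?_, ?_, ?_⟩, ?_⟩
        · dsimp only; linarith
        · exact ha
        · dsimp only; linarith
        · dsimp only
          rw [heq]
          dsimp only
          congr 3
          ring
    _ = ENNReal.ofReal |cross u v| *
          ∫⁻ z in s, busemann (domain p) (center p + v + planeMap (-v) (u - v) z) := by
        rw [hilbertMeasure_apply hAΩ, hA, lintegral_planeMap_image _ (by
          rw [← abs_pos, hcross]; exact hD') hsm, hcross]
    _ ≤ ENNReal.ofReal |cross u v| * ∫⁻ z in s, ENNReal.ofReal (2 * Real.pi / |cross u v|) *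
          (ENNReal.ofReal (1 / z.re) * ENNReal.ofReal (1 / (z.im + η))) := by
        refine mul_le_mul_right (setLIntegral_mono' hsm fun z hz => ?_) _
        obtain ⟨h1, h2, h3⟩ := hz
        have hz0 : 0 < z.re := h0.trans_le h1
        rw [heq]
        refine (busemann_le_of_rhombus hp hu hu' hv hv' hD h2 hz0 h3).trans ?_
        rw [← ENNReal.ofReal_mul (by positivity), ← ENNReal.ofReal_mul (by positivity)]
        apply ENNReal.ofReal_le_ofReal
        rw [← mul_assoc]
        apply mul_le_mul_of_nonneg_left _ (by positivity)
        apply one_div_le_one_div_of_le <;> linarith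
    _ = ENNReal.ofReal (2 * Real.pi) * ∫⁻ z in s,
          (ENNReal.ofReal (1 / z.re) * ENNReal.ofReal (1 / (z.im + η))) := by
        rw [lintegral_const_mul' _ _ ENNReal.ofReal_ne_top, ← mul_assoc,
          ← ENNReal.ofReal_mul hD'.le, mul_div_cancel₀ _ hD'.ne']
    _ ≤ ENNReal.ofReal (2 * Real.pi) * ∫⁻ z in Icc η 1 ×ℂ Icc 0 1,
          (ENNReal.ofReal (1 / z.re) * ENNReal.ofReal (1 / (z.im + η))) := by
        refine mul_le_mul_right (lintegral_mono_set ?_) _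
        rintro z ⟨h1, h2, h3⟩
        exact ⟨⟨h1, by linarith⟩, ⟨h2, by linarith⟩⟩
    _ ≤ _ := by
        rw [ENNReal.ofReal_mul (p := 2 * Real.pi) (by positivity)]
        exact mul_le_mul_right (lintegral_inv_mul_inv h0 h1) _

theorem hilbertMeasure_sector_le (hp : 2 < p) {u v : ℂ}
    (hu : center p + u ∈ boundaryCurve p)
    (hu' : center p - u ∈ boundaryCurve p) (hv : center p + v ∈ boundaryCurve p)
    (hv' : center p - v ∈ boundaryCurve p) (hD : cross u v ≠ 0) {η : ℝ} (h0 : 0 < η)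
    (h1 : η ≤ 1) :
    hilbertMeasure (domain p) {y | ∃ a b : ℝ, 0 ≤ a ∧ 0 ≤ b ∧ a + b ≤ 1 - η ∧
      y = center p + (a • u + b • v)} ≤
      ENNReal.ofReal (4 * Real.pi * (Real.log (1 / η) + 1) ^ 2) := by
  have hD' : cross v u ≠ 0 := by rw [cross_swap]; exact neg_ne_zero.2 hD
  have e : ENNReal.ofReal (4 * Real.pi * (Real.log (1 / η) + 1) ^ 2) =
      ENNReal.ofReal (2 * Real.pi * (Real.log (1 / η) + 1) ^ 2) +
      ENNReal.ofReal (2 * Real.pi * (Real.log (1 / η) + 1) ^ 2) := by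
    rw [← ENNReal.ofReal_add (by positivity) (by positivity)]
    congr 1; ring
  rw [e]
  refine le_trans (measure_mono ?_) ((measure_union_le _ _).trans (add_le_add
    (hilbertMeasure_half_sector_le hp hu hu' hv hv' hD h0 h1)
    (hilbertMeasure_half_sector_le hp hv hv' hu hu' hD' h0 h1)))
  rintro y ⟨a, b, ha, hb, hab, rfl⟩
  rcases le_total a b with h | h
  · left; exact ⟨a, b, ha, h, hab, rfl⟩
  · right; exact ⟨b, a, hb, h, by linarith, by rw [add_comm (a • u)]⟩

theorem cross_radius_radius_nonneg (hp : 2 < p) {s t : ℝ} (hs : 0 ≤ s) (hst : s ≤ t)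
    (ht : t ≤ 1) : 0 ≤ cross (radius p s) (radius p t) := by
  have e : 2 * cross (radius p s) (radius p t) =
      cross (curve p s - curve p 0) (curve p t - curve p s) +
      cross (curve p t - curve p s) (curve p 1 - curve p t) := by
    have h : radius p s + radius p t = (curve p s - curve p 0) - (curve p 1 - curve p t) := by
      simp only [radius, center]; ring
    rw [cross_swap _ (curve p 1 - curve p t), ← sub_eq_add_neg, ← cross_sub_left, ← h,
      ← radius_sub, cross_add_left, cross_sub_right, cross_sub_right, cross_self, cross_self,
      cross_swap (radius p t)]
    ring
  have h1 := cross_chord_chord_nonneg hp le_rfl hs le_rfl hst ht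
  have h2 := cross_chord_chord_nonneg hp hs hst le_rfl ht le_rfl
  linarith

/-- The part of the domain that is seen from the centre through the piece `[t₀, t₁]` of the curve
and that lies in the homothetic copy of ratio `1 - η`. The hypothesis `hcap` says that the cap cut
by the chord of this piece is thin compared with `η`. -/
theorem hilbertMeasure_piece_le (hp : 2 < p) {t₀ t₁ η ε : ℝ} (ht₀ : 0 ≤ t₀) (ht₁ : t₁ ≤ 1)
    (hD : 0 < cross (radius p t₀) (radius p t₁)) (h0 : 0 < η) (h1 : η ≤ 1)
    (hε : ε = 1 ∨ ε = -1)
    (hcap : ∀ t ∈ Icc t₀ t₁, cross (curve p t - curve p t₀) (curve p t₁ - curve p t) ≤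
      η / 2 * cross (radius p t₀) (radius p t₁)) :
    hilbertMeasure (domain p) {y | ∃ t ∈ Icc t₀ t₁, ∃ s ∈ Icc 0 (1 - η),
      y = center p + s • ε • radius p t} ≤
      ENNReal.ofReal (4 * Real.pi * (Real.log (1 / η) + 2) ^ 2) := by
  rcases le_or_gt t₀ t₁ with h01 | h01
  swap
  · simp [Icc_eq_empty_of_lt h01]
  have hmem : ∀ t ∈ Icc (0 : ℝ) 1, center p + ε • radius p t ∈ boundaryCurve p ∧
      center p - ε • radius p t ∈ boundaryCurve p := by
    intro t ht
    rw [boundaryCurve_eq]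
    rcases hε with rfl | rfl
    · exact ⟨⟨t, ht, Or.inl (by module)⟩, ⟨t, ht, Or.inr (by module)⟩⟩
    · exact ⟨⟨t, ht, Or.inr (by module)⟩, ⟨t, ht, Or.inl (by module)⟩⟩
  have hεε : ε * ε = 1 := by rcases hε with rfl | rfl <;> norm_num
  obtain ⟨hu, hu'⟩ := hmem t₀ ⟨ht₀, h01.trans ht₁⟩
  obtain ⟨hv, hv'⟩ := hmem t₁ ⟨ht₀.trans h01, ht₁⟩
  have hlog : 0 ≤ Real.log (1 / η) := Real.log_nonneg ((one_le_div h0).2 h1)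
  have hcross : cross (ε • radius p t₀) (ε • radius p t₁) = cross (radius p t₀) (radius p t₁) := by
    rw [cross_smul_left, cross_smul_right, ← mul_assoc, hεε, one_mul]
  refine le_trans (measure_mono ?_) ((hilbertMeasure_sector_le hp hu hu' hv hv'
    (by rw [hcross]; exact hD.ne') (half_pos h0) (by linarith)).trans ?_)
  · rintro y ⟨t, ht, s, hs, rfl⟩
    have e1 := eq_add_smul_of_cross_ne_zero hD.ne' (radius p t)
    have a1 := cross_radius_radius_nonneg hp ht₀ ht.1 (ht.2.trans ht₁)
    have a2 := cross_radius_radius_nonneg hp (ht₀.trans ht.1) ht.2 ht₁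
    have a3 := hcap t ht
    rw [← radius_sub, ← radius_sub, cross_sub_left, cross_sub_right, cross_sub_right, cross_self]
      at a3
    set D := cross (radius p t₀) (radius p t₁)
    set b1 := cross (radius p t) (radius p t₁)
    set b2 := cross (radius p t₀) (radius p t)
    refine ⟨s * (b1 / D), s * (b2 / D), mul_nonneg hs.1 (div_nonneg a2 hD.le),
      mul_nonneg hs.1 (div_nonneg a1 hD.le), ?_, ?_⟩
    · have h3 : b1 / D + b2 / D ≤ 1 + η / 2 := by
        rw [← add_div, div_le_iff₀ hD]; linarith
      calc s * (b1 / D) + s * (b2 / D) = s * (b1 / D + b2 / D) := by ring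
        _ ≤ (1 - η) * (1 + η / 2) := by
          apply mul_le_mul hs.2 h3 _ (by linarith)
          exact add_nonneg (div_nonneg a2 hD.le) (div_nonneg a1 hD.le)
        _ ≤ 1 - η / 2 := by nlinarith
    · conv_lhs => rw [e1]
      module
  · apply ENNReal.ofReal_le_ofReal
    have e2 : Real.log (1 / (η / 2)) ≤ Real.log (1 / η) + 1 := by
      rw [show 1 / (η / 2) = 1 / η * 2 by field_simp, Real.log_mul (by positivity) two_ne_zero]
      linarith [Real.log_two_lt_d9]
    have e3 : 0 ≤ Real.log (1 / (η / 2)) :=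
      Real.log_nonneg ((one_le_div (by linarith)).2 (by linarith))
    apply mul_le_mul_of_nonneg_left _ (by positivity)
    apply pow_le_pow_left₀ <;> linarith

/-- The homothetic copy of the domain of ratio `1 - η` with the same centre. -/
def shrunkDomain (p η : ℝ) : Set ℂ :=
  {y | ∃ t ∈ Icc (0 : ℝ) 1, ∃ s ∈ Icc 0 (1 - η),
    y = center p + s • radius p t ∨ y = center p - s • radius p t}

theorem le_cross_radius_arc (hp : 2 < p) {r : ℝ}
    (hr : ∀ t ∈ Icc (0 : ℝ) 1, r ≤ cross (radius p t) (tangent p t)) {n k : ℕ} (hk : k < 2 ^ n)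
    (hn : 1 / p ^ n ≤ r / 2) :
    r / 2 * (1 / p ^ n) ≤ cross (radius p (arcLeft p n k)) (radius p (arcRight p n k)) := by
  have hp0 : 0 < p := by linarith
  have hpn : 0 < 1 / p ^ n := by positivity
  have hl := arcLeft_mem hp hk
  have hR := arcRight_mem hp hk
  have hlen : arcRight p n k - arcLeft p n k = 1 / p ^ n := add_sub_cancel_left _ _
  have h := le_cross_curve_sub hp (z := radius p (arcLeft p n k)) (c := r / 2) hl hR
    (by linarith) fun u hu => by
      have hu' : u ∈ Icc (0 : ℝ) 1 := ⟨hl.1.trans hu.1, hu.2.trans hR.2⟩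
      have h1 := hr u hu'
      have h2 : radius p u = radius p (arcLeft p n k) + (curve p u - curve p (arcLeft p n k)) := by
        simp only [radius]; ring
      rw [h2, cross_add_left] at h1
      have h3 := (le_abs_self _).trans
        (abs_cross_le (curve p u - curve p (arcLeft p n k)) (tangent p u))
      rw [norm_tangent, mul_one] at h3
      have h4 := norm_curve_sub_le hp hl hu'
      rw [abs_of_nonneg (by linarith [hu.1])] at h4
      linarith [hu.2]
  rw [hlen] at h
  rwa [← sub_zero (cross _ (radius p (arcRight p n k))), ← cross_self (radius p (arcLeft p n k)),
    ← cross_sub_right, radius_sub]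

theorem arc_cap_le (hp : 2 < p) {n k : ℕ} (hk : k < 2 ^ n) {t : ℝ}
    (ht : t ∈ Icc (arcLeft p n k) (arcRight p n k)) :
    cross (curve p t - curve p (arcLeft p n k)) (curve p (arcRight p n k) - curve p t) ≤
      Real.pi / 2 ^ n * (1 / p ^ n) ^ 2 := by
  have hp0 : 0 < p := by linarith
  have hpn : 0 < 1 / p ^ n := by positivity
  have hl := arcLeft_mem hp hk
  have hR := arcRight_mem hp hk
  have hlen : arcRight p n k - arcLeft p n k = 1 / p ^ n := add_sub_cancel_left _ _
  have ht' : t ∈ Icc (0 : ℝ) 1 := ⟨hl.1.trans ht.1, ht.2.trans hR.2⟩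
  have h := cross_chord_chord_le hp (c := Real.pi / 2 ^ n) hl ht' ht.1 ht' hR ht.2
    fun u hu v hv => by
      have hu' : u ∈ Icc (0 : ℝ) 1 := ⟨hl.1.trans hu.1, hu.2.trans ht'.2⟩
      have hv' : v ∈ Icc (0 : ℝ) 1 := ⟨ht'.1.trans hv.1, hv.2.trans hR.2⟩
      have h1 := cantorLebesgue_monotoneOn hp hl hu' hu.1
      have h2 := cantorLebesgue_monotoneOn hp hv' hR hv.2
      have h3 := cantorLebesgue_monotoneOn hp hu' hv' (hu.2.trans hv.1)
      rw [cantorLebesgue_arcLeft hp hk] at h1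
      rw [cantorLebesgue_arcRight hp hk, add_div] at h2
      refine (Real.sin_le (mul_nonneg Real.pi_nonneg (by linarith))).trans ?_
      rw [div_eq_mul_one_div]
      exact mul_le_mul_of_nonneg_left (by linarith) Real.pi_nonneg
  refine h.trans ?_
  rw [mul_assoc, sq]
  apply mul_le_mul_of_nonneg_left _ (by positivity)
  apply mul_le_mul <;> linarith [ht.1, ht.2]

theorem cantorLebesgue_gap (hp : 2 < p) {n k : ℕ} (hk : k + 1 < 2 ^ n) {t : ℝ}
    (ht : t ∈ Icc (arcRight p n k) (arcLeft p n (k + 1))) :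
    t ∈ Icc (0 : ℝ) 1 ∧ cantorLebesgue p t = (k + 1) / 2 ^ n := by
  have hk' : k < 2 ^ n := by omega
  have hR := arcRight_mem hp hk'
  have hl := arcLeft_mem hp hk
  have ht' : t ∈ Icc (0 : ℝ) 1 := ⟨hR.1.trans ht.1, ht.2.trans hl.2⟩
  have h1 := cantorLebesgue_monotoneOn hp hR ht' ht.1
  have h2 := cantorLebesgue_monotoneOn hp ht' hl ht.2
  rw [cantorLebesgue_arcRight hp hk'] at h1
  rw [cantorLebesgue_arcLeft hp hk] at h2
  push_cast at h2
  exact ⟨ht', le_antisymm h2 h1⟩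

theorem cross_radius_gap_pos (hp : 2 < p) {n k : ℕ} (hk : k + 1 < 2 ^ n) :
    0 < cross (radius p (arcRight p n k)) (radius p (arcLeft p n (k + 1))) := by
  obtain ⟨r, hr0, hr⟩ := exists_le_cross_radius_tangent hp
  have hlt := arcRight_lt_arcLeft_succ hp n k hk
  have hR := arcRight_mem hp (show k < 2 ^ n by omega)
  have hl := arcLeft_mem hp hk
  have h := le_cross_curve_sub hp (z := radius p (arcRight p n k)) (c := r) hR hl hlt.le
    fun u hu => by
      have h1 := hr _ hR
      have h2 : tangent p u = tangent p (arcRight p n k) := by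
        rw [tangent, tangent, (cantorLebesgue_gap hp hk hu).2,
          (cantorLebesgue_gap hp hk (left_mem_Icc.2 hlt.le)).2]
      rwa [h2]
  rw [← radius_sub, cross_sub_right, cross_self, sub_zero] at h
  exact lt_of_lt_of_le (mul_pos hr0 (by linarith)) h

theorem gap_cap_le (hp : 2 < p) {n k : ℕ} (hk : k + 1 < 2 ^ n) {t : ℝ}
    (ht : t ∈ Icc (arcRight p n k) (arcLeft p n (k + 1))) :
    cross (curve p t - curve p (arcRight p n k)) (curve p (arcLeft p n (k + 1)) - curve p t) ≤
      0 := by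
  have hlt := arcRight_lt_arcLeft_succ hp n k hk
  have h := cross_chord_chord_le hp (c := 0) (cantorLebesgue_gap hp hk (left_mem_Icc.2 hlt.le)).1
    (cantorLebesgue_gap hp hk ht).1 ht.1 (cantorLebesgue_gap hp hk ht).1
    (cantorLebesgue_gap hp hk (right_mem_Icc.2 hlt.le)).1 ht.2 fun u hu v hv => by
      rw [(cantorLebesgue_gap hp hk ⟨hu.1, hu.2.trans ht.2⟩).2,
        (cantorLebesgue_gap hp hk ⟨ht.1.trans hv.1, hv.2⟩).2]
      simp
  simpa using h

/-- The upper bound: `shrunkDomain p η` is covered by sectors over the `2 ^ n` increasing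
intervals of stage `n` and over the flat intervals between them. -/
theorem exists_hilbertMeasure_shrunkDomain_le (hp : 2 < p) :
    ∃ C : ℝ, 0 < C ∧ ∃ n₀ : ℕ, ∀ n ≥ n₀, ∀ η : ℝ, 0 < η → η ≤ 1 → C / (2 * p) ^ n ≤ η →
      hilbertMeasure (domain p) (shrunkDomain p η) ≤
        ENNReal.ofReal (2 ^ n * (16 * Real.pi * (Real.log (1 / η) + 2) ^ 2)) := by
  have hp0 : 0 < p := by linarith
  obtain ⟨r, hr0, hr⟩ := exists_le_cross_radius_tangent hp
  obtain ⟨n₀, hn₀⟩ := exists_pow_lt_of_lt_one (half_pos hr0)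
    (show p⁻¹ < 1 from inv_lt_one_of_one_lt₀ (by linarith))
  refine ⟨4 * Real.pi / r, by positivity, n₀, fun n hn η h0 h1 hη => ?_⟩
  have hpn : 0 < 1 / p ^ n := by positivity
  have hn' : 1 / p ^ n ≤ r / 2 := by
    have h2 : p⁻¹ ^ n ≤ p⁻¹ ^ n₀ :=
      pow_le_pow_of_le_one (by positivity) (inv_le_one_of_one_le₀ (by linarith)) hn
    rw [inv_pow] at h2
    rw [one_div]
    linarith
  set M := ENNReal.ofReal (4 * Real.pi * (Real.log (1 / η) + 2) ^ 2)
  set P : ℝ → ℝ → ℝ → Set ℂ := fun ε t₀ t₁ => {y | ∃ t ∈ Icc t₀ t₁, ∃ s ∈ Icc 0 (1 - η),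
      y = center p + s • ε • radius p t} with hP
  have harc : ∀ k < 2 ^ n, ∀ ε, ε = 1 ∨ ε = -1 →
      hilbertMeasure (domain p) (P ε (arcLeft p n k) (arcRight p n k)) ≤ M := by
    intro k hk ε hε
    have hD := le_cross_radius_arc hp hr hk hn'
    refine hilbertMeasure_piece_le hp (arcLeft_mem hp hk).1 (arcRight_mem hp hk).2
      (lt_of_lt_of_le (by positivity) hD) h0 h1 hε fun t ht => (arc_cap_le hp hk ht).trans ?_
    refine le_trans ?_ (mul_le_mul_of_nonneg_left hD (by positivity))
    have e : Real.pi / 2 ^ n * (1 / p ^ n) ^ 2 =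
        4 * Real.pi / r / (2 * p) ^ n / 2 * (r / 2 * (1 / p ^ n)) := by
      rw [mul_pow]; field_simp; ring
    rw [e]
    apply mul_le_mul_of_nonneg_right _ (by positivity)
    linarith
  have hgap : ∀ k, k + 1 < 2 ^ n → ∀ ε, ε = 1 ∨ ε = -1 →
      hilbertMeasure (domain p) (P ε (arcRight p n k) (arcLeft p n (k + 1))) ≤ M := by
    intro k hk ε hε
    have hD := cross_radius_gap_pos hp hk
    exact hilbertMeasure_piece_le hp (arcRight_mem hp (by omega)).1 (arcLeft_mem hp hk).2
      hD h0 h1 hε fun t ht => (gap_cap_le hp hk ht).trans (by positivity)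
  have hcover : shrunkDomain p η ⊆ ⋃ k ∈ Finset.range (2 ^ n),
      ((P 1 (arcLeft p n k) (arcRight p n k) ∪ P (-1) (arcLeft p n k) (arcRight p n k)) ∪
      if k + 1 < 2 ^ n then P 1 (arcRight p n k) (arcLeft p n (k + 1)) ∪
        P (-1) (arcRight p n k) (arcLeft p n (k + 1)) else ∅) := by
    rintro y ⟨t, ht, s, hs, hy⟩
    simp only [mem_iUnion, Finset.mem_range]
    have hmem : ∀ t₀ t₁, t ∈ Icc t₀ t₁ → y ∈ P 1 t₀ t₁ ∪ P (-1) t₀ t₁ := by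
      intro t₀ t₁ htt
      rcases hy with rfl | rfl
      · left; exact ⟨t, htt, s, hs, by rw [one_smul]⟩
      · right; exact ⟨t, htt, s, hs, by module⟩
    rcases exists_mem_arc_or_gap hp n t ht with ⟨k, hk, htk⟩ | ⟨k, hk, htk⟩
    · exact ⟨k, hk, Or.inl (hmem _ _ htk)⟩
    · refine ⟨k, by omega, Or.inr ?_⟩
      rw [if_pos hk]
      exact hmem _ _ htk
  refine (measure_mono hcover).trans ((measure_biUnion_finset_le _ _).trans ?_)
  have hbound : ∀ k ∈ Finset.range (2 ^ n), hilbertMeasure (domain p)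
      ((P 1 (arcLeft p n k) (arcRight p n k) ∪ P (-1) (arcLeft p n k) (arcRight p n k)) ∪
      if k + 1 < 2 ^ n then P 1 (arcRight p n k) (arcLeft p n (k + 1)) ∪
        P (-1) (arcRight p n k) (arcLeft p n (k + 1)) else ∅) ≤ M + M + (M + M) := by
    intro k hk
    have hk' : k < 2 ^ n := by simpa using hk
    refine (measure_union_le _ _).trans (add_le_add ((measure_union_le _ _).trans
      (add_le_add (harc k hk' _ (Or.inl rfl)) (harc k hk' _ (Or.inr rfl)))) ?_)
    split_ifs with h
    · exact (measure_union_le _ _).trans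
        (add_le_add (hgap k h _ (Or.inl rfl)) (hgap k h _ (Or.inr rfl)))
    · simp
  refine (Finset.sum_le_card_nsmul _ _ _ hbound).trans (le_of_eq ?_)
  rw [Finset.card_range, nsmul_eq_mul, ← ENNReal.ofReal_add (by positivity) (by positivity),
    ← ENNReal.ofReal_add (by positivity) (by positivity), ENNReal.ofReal_mul (by positivity),
    ENNReal.ofReal_pow (by norm_num)]
  congr 2
  · simp
  · ring

/-- Hilbert balls are contained in shrunk domains. -/
theorem exists_hilbertBall_subset_shrunkDomain (hp : 2 < p) {x : ℂ} (hx : x ∈ domain p) :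
    ∃ c : ℝ, 0 < c ∧ c ≤ 1 ∧ ∀ R : ℝ, 0 ≤ R →
      hilbertBall (domain p) x R ⊆ shrunkDomain p (c * Real.exp (-(2 * R))) := by
  have ho := isOpen_domain (p := p)
  have hc := convex_domain (p := p)
  have hb := isBounded_domain hp
  have ho' := center_mem_domain hp
  have hG : gaugeAt (domain p) (center p) (x - center p) < 1 := by
    rw [gaugeAt_lt_one_iff ho hc ho']; simpa using hx
  have hG0 : 0 ≤ gaugeAt (domain p) (center p) (x - center p) := gaugeAt_nonneg
  set G := gaugeAt (domain p) (center p) (x - center p)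
  refine ⟨(1 - G) / 2, by linarith, by linarith, fun R hR y hy => ?_⟩
  obtain ⟨hy, hyR⟩ := hilbertBall_subset ho hc hb hx R hy
  set e := Real.exp (-(2 * R))
  have he0 : 0 < e := Real.exp_pos _
  have he1 : e ≤ 1 := Real.exp_le_one_iff.2 (by linarith)
  obtain ⟨t, ht, s, hs, hys⟩ := exists_eq_center_add_smul_radius hp y
  refine ⟨t, ht, s, ⟨hs, ?_⟩, hys⟩
  have hGs : gaugeAt (domain p) (center p) (y - center p) = s := by
    have h1 : ∀ w, center p + w ∈ boundaryCurve p → gaugeAt (domain p) (center p) w = 1 := by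
      intro w hw
      rwa [gaugeAt_eq_one_iff ho hc ho', frontier_domain hp]
    have h2 : center p + radius p t ∈ boundaryCurve p ∧
        center p + -radius p t ∈ boundaryCurve p := by
      rw [boundaryCurve_eq]
      exact ⟨⟨t, ht, Or.inl rfl⟩, ⟨t, ht, Or.inr (by ring)⟩⟩
    rcases hys with rfl | rfl
    · rw [add_sub_cancel_left, gaugeAt_smul hs, h1 _ h2.1, mul_one]
    · rw [sub_sub_cancel_left, ← smul_neg, gaugeAt_smul hs, h1 _ h2.2, mul_one]
  have hB : gaugeAt (domain p) (center p) (y + e • (y - x) - center p) < 1 := by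
    rw [gaugeAt_lt_one_iff ho hc ho']; simpa using hyR
  have hsum : (1 + e) • (y - center p) = (y + e • (y - x) - center p) + e • (x - center p) := by
    module
  have h3 := gaugeAt_add_le ho hc ho' (y + e • (y - x) - center p) (e • (x - center p))
  rw [← hsum, gaugeAt_smul (by positivity), gaugeAt_smul he0.le, hGs] at h3
  change (1 + e) * s ≤ _ + e * G at h3
  nlinarith [mul_nonneg he0.le (mul_nonneg (sub_nonneg.2 he1) (sub_nonneg.2 hG.le))]

/-! ### The lower bound -/

/-- A cap below a chord `(0, 0) (w₁, w₂)`, bounded by the horizontal line through `(0, 0)` and by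
the line of direction `(c, s)` through `(w₁, w₂)`, is contained in the box with diagonal this chord.
The point `(x', y')` strictly inside the cap excludes degenerate positions of the three lines. -/
theorem mem_box_of_mem_cap {c s w₁ w₂ x y x' y' : ℝ} (hc : 0 < c) (hw₁ : 0 ≤ w₁) (hw₂ : 0 ≤ w₂)
    (hV : 0 ≤ w₁ * s - w₂ * c) (hy' : 0 ≤ y') (hR' : 0 ≤ c * (y' - w₂) - s * (x' - w₁))
    (hin : w₁ * y' - w₂ * x' < 0) (hy : 0 ≤ y) (hR : 0 ≤ c * (y - w₂) - s * (x - w₁))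
    (hz : w₁ * y - w₂ * x ≤ 0) : x ∈ Icc 0 w₁ ∧ y ∈ Icc 0 w₂ := by
  have hw₂' : 0 < w₂ := by
    refine lt_of_le_of_ne hw₂ fun h => ?_
    rw [← h] at hin
    nlinarith [mul_nonneg hw₁ hy']
  have hw₁' : 0 < w₁ := by
    refine lt_of_le_of_ne hw₁ fun h => ?_
    rw [← h] at hV
    nlinarith [mul_pos hw₂' hc]
  have hV' : 0 < w₁ * s - w₂ * c := by
    refine lt_of_le_of_ne hV fun h => ?_
    have h1 := mul_nonneg hw₁ hR'
    have h2 : w₁ * (c * (y' - w₂) - s * (x' - w₁)) =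
        c * (w₁ * y' - w₂ * x') - (x' - w₁) * (w₁ * s - w₂ * c) := by ring
    rw [h2, ← h] at h1
    nlinarith [mul_pos hc (neg_pos.2 hin)]
  have hx : 0 ≤ x := by
    by_contra hx
    nlinarith [mul_nonneg hw₁ hy, mul_pos hw₂' (neg_pos.2 (not_le.1 hx))]
  have hxw : x ≤ w₁ := by
    by_contra hx
    have h1 := mul_nonneg hw₁ hR
    have h2 : w₁ * (c * (y - w₂) - s * (x - w₁)) =
        c * (w₁ * y - w₂ * x) - (x - w₁) * (w₁ * s - w₂ * c) := by ring
    rw [h2] at h1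
    nlinarith [mul_nonneg hc.le (neg_nonneg.2 hz), mul_pos (sub_pos.2 (not_le.1 hx)) hV']
  refine ⟨⟨hx, hxw⟩, hy, ?_⟩
  by_contra h
  nlinarith [mul_pos hw₁' (sub_pos.2 (not_le.1 h)), mul_nonneg hw₂ (sub_nonneg.2 hxw)]

/-- The cap that the chord of an increasing interval cuts off the domain. -/
def arcCap (p : ℝ) (n k : ℕ) : Set ℂ :=
  {z | z ∈ domain p ∧
    cross (curve p (arcRight p n k) - curve p (arcLeft p n k)) (z - curve p (arcLeft p n k)) ≤ 0}

theorem pow_le_cross_arc_triangle (hp : 2 < p) {n k : ℕ} (hk : k < 2 ^ n) :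
    (1 - 2 / p) / p ^ 2 / 2 * (1 / p ^ n) ^ 2 / 2 ^ n ≤
      cross (curve p (arcLeft p n k + 1 / p / p ^ n) - curve p (arcLeft p n k))
        (curve p (arcRight p n k) - curve p (arcLeft p n k)) := by
  have hp0 : 0 < p := by linarith
  refine le_trans ?_ (le_cross_arc_triangle hp hk)
  have h1 : 1 / (2 : ℝ) ^ n ≤ 1 := by
    rw [div_le_one (by positivity)]; exact one_le_pow₀ (by norm_num)
  have h2 : Real.pi / 2 ^ n / 4 ≤ Real.pi / 2 := by
    have : Real.pi / 2 ^ n / 4 = Real.pi / 4 * (1 / 2 ^ n) := by ring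
    rw [this]
    nlinarith [Real.pi_pos]
  have h3 := Real.mul_le_sin (x := Real.pi / 2 ^ n / 4) (by positivity) h2
  have e : 2 / Real.pi * (Real.pi / 2 ^ n / 4) = 1 / 2 / 2 ^ n := by
    field_simp; norm_num
  rw [e] at h3
  have h4 : 0 ≤ 1 - 2 / p := by
    rw [sub_nonneg, div_le_one hp0]; exact hp.le
  calc (1 - 2 / p) / p ^ 2 / 2 * (1 / p ^ n) ^ 2 / 2 ^ n =
      (1 - 2 / p) / p ^ 2 * (1 / p ^ n) ^ 2 * (1 / 2 / 2 ^ n) := by ring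
    _ ≤ _ := mul_le_mul_of_nonneg_left h3 (by positivity)

/-- The cap lies between the chord and the tangents at its two ends, hence in a box of width `p ⁻ⁿ`
and of height `π 2 ⁻ⁿ p ⁻ⁿ`. -/
theorem volume_arcCap_le (hp : 2 < p) {n k : ℕ} (hk : k < 2 ^ n) (hn : 2 ≤ n) :
    volume (arcCap p n k) ≤ ENNReal.ofReal (Real.pi / 2 ^ n * (1 / p ^ n) ^ 2) := by
  have hp0 : 0 < p := by linarith
  have hpn : 0 < 1 / p ^ n := by positivity
  have hl := arcLeft_mem hp hk
  have hr := arcRight_mem hp hk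
  have hlen : arcRight p n k - arcLeft p n k = 1 / p ^ n := add_sub_cancel_left _ _
  have hfl := cantorLebesgue_arcLeft hp hk
  have hfr := cantorLebesgue_arcRight hp hk
  have hDpos := pow_le_cross_arc_triangle hp hk
  have hB : curve p (arcLeft p n k + 1 / p / p ^ n) ∈ convexHull ℝ (boundaryCurve p) :=
    curve_mem_hull (arcLeft_add_mem hp n k hk _
      ⟨by positivity, by rw [div_le_one hp0]; linarith⟩).1
  rw [arcCap]
  set l := arcLeft p n k
  set r := arcRight p n k
  set w := curve p r - curve p l with hw
  set e := tangent p l with he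
  set θ := Real.pi / 2 ^ n with hθ
  have hθ0 : 0 < θ := by positivity
  have hθ4 : θ ≤ Real.pi / 4 := by
    have h4 : (4 : ℝ) ≤ 2 ^ n := by
      calc (4 : ℝ) = 2 ^ 2 := by norm_num
        _ ≤ 2 ^ n := pow_le_pow_right₀ (by norm_num) hn
    exact div_le_div_of_nonneg_left Real.pi_nonneg (by norm_num) h4
  have hcos : 0 < Real.cos θ := Real.cos_pos_of_mem_Ioo
    ⟨by linarith [Real.pi_pos], by linarith [Real.pi_pos]⟩
  have hangle : ∀ u ∈ Icc l r, 0 ≤ Real.pi * (cantorLebesgue p u - cantorLebesgue p l) ∧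
      Real.pi * (cantorLebesgue p u - cantorLebesgue p l) ≤ θ := by
    intro u hu
    have hu' : u ∈ Icc (0 : ℝ) 1 := ⟨hl.1.trans hu.1, hu.2.trans hr.2⟩
    have h1 := cantorLebesgue_monotoneOn hp hl hu' hu.1
    have h2 := cantorLebesgue_monotoneOn hp hu' hr hu.2
    rw [hfr, add_div] at h2
    rw [hfl] at h1 ⊢
    refine ⟨mul_nonneg Real.pi_nonneg (by linarith), ?_⟩
    rw [hθ, div_eq_mul_one_div Real.pi]
    exact mul_le_mul_of_nonneg_left (by linarith) Real.pi_nonneg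
  -- Coordinates in the orthonormal frame `(e, i e)`.
  have he1 : e.re * e.re + e.im * e.im = 1 := by
    rw [← Complex.normSq_apply, Complex.normSq_eq_norm_sq, he, norm_tangent, one_pow]
  have hframe : cross e (Complex.I * e) = 1 := by
    simp only [cross, Complex.mul_re, Complex.mul_im, Complex.I_re, Complex.I_im]
    linarith
  have htr : tangent p r = Real.cos θ • e + Real.sin θ • (Complex.I * e) := by
    have h1 : Real.pi * cantorLebesgue p r = θ + Real.pi * cantorLebesgue p l := by
      rw [hfr, hfl]; ring
    apply Complex.ext
    · simp only [he, Complex.add_re, Complex.smul_re, smul_eq_mul, Complex.mul_re,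
        Complex.I_re, Complex.I_im, tangent_re, tangent_im, h1, Real.cos_add]
      ring
    · simp only [he, Complex.add_im, Complex.smul_im, smul_eq_mul, Complex.mul_im,
        Complex.I_re, Complex.I_im, tangent_re, tangent_im, h1, Real.sin_add]
      ring
  have hw₁ : 0 ≤ cross w (Complex.I * e) := by
    have := le_cross_curve_sub hp (z := -(Complex.I * e)) (c := 0) hl hr (by linarith)
      fun u hu => by
        obtain ⟨h1, h2⟩ := hangle u hu
        have h3 : cross (-(Complex.I * e)) (tangent p u) =
            Real.cos (Real.pi * (cantorLebesgue p u - cantorLebesgue p l)) := by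
          rw [mul_sub, Real.cos_sub, ← tangent_re, ← tangent_re, ← tangent_im, ← tangent_im,
            ← he]
          simp only [cross, Complex.neg_re, Complex.neg_im, Complex.mul_re, Complex.mul_im,
            Complex.I_re, Complex.I_im]
          ring
        rw [h3]
        exact Real.cos_nonneg_of_neg_pi_div_two_le_of_le (by linarith [Real.pi_pos])
          (by linarith [Real.pi_pos])
    rwa [zero_mul, cross_neg_left, ← cross_swap] at this
  have hw₂ : 0 ≤ cross e w := cross_tangent_chord_nonneg hp hl.1 le_rfl (by linarith) hr.2
  have hw₁' : cross w (Complex.I * e) ≤ 1 / p ^ n := by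
    refine (le_abs_self _).trans ((abs_cross_le _ _).trans ?_)
    rw [norm_mul, Complex.norm_I, he, norm_tangent, one_mul, mul_one]
    have := norm_curve_sub_le hp hl hr
    rwa [hlen, abs_of_pos hpn] at this
  have hw₂' : cross e w ≤ θ * (1 / p ^ n) := by
    have := cross_curve_sub_le hp (z := e) (c := θ) hl hr (by linarith) fun u hu => by
      obtain ⟨h1, h2⟩ := hangle u hu
      rw [he, cross_tangent]
      exact (Real.sin_le h1).trans h2
    rwa [hlen] at this
  have hcoord : ∀ a b : ℂ, cross a b =
      cross a (Complex.I * e) * cross e b - cross e a * cross b (Complex.I * e) := by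
    intro a b
    simp only [cross, Complex.mul_re, Complex.mul_im, Complex.I_re, Complex.I_im]
    linear_combination (-(a.re * b.im - a.im * b.re)) * he1
  have htr' : ∀ u : ℂ, cross (tangent p r) u =
      Real.cos θ * cross e u - Real.sin θ * cross u (Complex.I * e) := by
    intro u
    rw [htr, cross_add_left, cross_smul_left, cross_smul_left, cross_swap (Complex.I * e)]
    ring
  have hV : 0 ≤ cross w (Complex.I * e) * Real.sin θ - cross e w * Real.cos θ := by
    have := cross_chord_tangent_nonneg hp hl.1 (by linarith : l ≤ r) le_rfl hr.2
    rw [cross_swap, htr'] at this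
    linarith
  have hsupp : ∀ z ∈ convexHull ℝ (boundaryCurve p), 0 ≤ Real.cos θ *
      (cross e (z - curve p l) - cross e w) -
        Real.sin θ * (cross (z - curve p l) (Complex.I * e) - cross w (Complex.I * e)) := by
    intro z hz
    have := cross_tangent_nonneg hp hr hz
    rw [show z - curve p r = (z - curve p l) - w by rw [hw]; ring, htr', cross_sub_left,
      cross_sub_right] at this
    exact this
  have hBin : cross w (Complex.I * e) * cross e (curve p (l + 1 / p / p ^ n) - curve p l) -
      cross e w * cross (curve p (l + 1 / p / p ^ n) - curve p l) (Complex.I * e) < 0 := by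
    rw [← hcoord, cross_swap]
    have h1 : 0 < 1 - 2 / p := by rw [sub_pos, div_lt_one hp0]; exact hp
    have : 0 < (1 - 2 / p) / p ^ 2 / 2 * (1 / p ^ n) ^ 2 / 2 ^ n := by positivity
    linarith
  have hsub : {z | z ∈ domain p ∧ cross w (z - curve p l) ≤ 0} ⊆
      (curve p l + ·) '' (planeMap e (Complex.I * e) ''
        (Icc 0 (1 / p ^ n) ×ℂ Icc 0 (θ * (1 / p ^ n)))) := by
    rintro z ⟨hz, hzw⟩
    have hzK := interior_subset hz
    rw [hcoord] at hzw
    obtain ⟨h1, h2⟩ := mem_box_of_mem_cap hcos hw₁ hw₂ hV (cross_tangent_nonneg hp hl hB)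
      (hsupp _ hB) hBin (cross_tangent_nonneg hp hl hzK) (hsupp _ hzK) hzw
    refine ⟨z - curve p l, ⟨⟨cross (z - curve p l) (Complex.I * e), cross e (z - curve p l)⟩,
      ⟨⟨h1.1, h1.2.trans hw₁'⟩, ⟨h2.1, h2.2.trans hw₂'⟩⟩, ?_⟩, by ring⟩
    have := eq_add_smul_of_cross_ne_zero (u := e) (v := Complex.I * e) (by rw [hframe]; norm_num)
      (z - curve p l)
    rw [hframe, div_one, div_one] at this
    rw [planeMap_apply]
    exact this.symm
  refine (measure_mono hsub).trans (le_of_eq ?_)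
  rw [image_add_left, measure_preimage_add, volume_planeMap_image, hframe, volume_reProdIm,
    Real.volume_Icc,
    Real.volume_Icc, sub_zero, sub_zero, abs_one, ENNReal.ofReal_one, one_mul,
    ← ENNReal.ofReal_mul hpn.le]
  congr 1
  ring

/-- The central part of the triangle inscribed in the cap of an increasing interval. -/
def arcCore (p : ℝ) (n k : ℕ) : Set ℂ :=
  (curve p (arcLeft p n k) + ·) ''
    (planeMap (curve p (arcLeft p n k + 1 / p / p ^ n) - curve p (arcLeft p n k))
      (curve p (arcRight p n k) - curve p (arcLeft p n k)) ''
      (Ioo (1 / 4) (3 / 8) ×ℂ Ioo (1 / 4) (3 / 8)))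

theorem mem_arcCore {n k : ℕ} {z : ℂ} (hz : z ∈ arcCore p n k) :
    ∃ x ∈ Ioo (1 / 4 : ℝ) (3 / 8), ∃ x' ∈ Ioo (1 / 4 : ℝ) (3 / 8),
      z = curve p (arcLeft p n k) +
        x • (curve p (arcLeft p n k + 1 / p / p ^ n) - curve p (arcLeft p n k)) +
        x' • (curve p (arcRight p n k) - curve p (arcLeft p n k)) := by
  obtain ⟨_, ⟨q, ⟨hq1, hq2⟩, rfl⟩, rfl⟩ := hz
  refine ⟨q.re, hq1, q.im, hq2, ?_⟩
  dsimp only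
  rw [planeMap_apply, add_assoc]

theorem cross_arc_triangle_pos (hp : 2 < p) {n k : ℕ} (hk : k < 2 ^ n) :
    0 < cross (curve p (arcLeft p n k + 1 / p / p ^ n) - curve p (arcLeft p n k))
        (curve p (arcRight p n k) - curve p (arcLeft p n k)) := by
  have hp0 : 0 < p := by linarith
  have h1 : 0 < 1 - 2 / p := by rw [sub_pos, div_lt_one hp0]; exact hp
  exact lt_of_lt_of_le (by positivity) (pow_le_cross_arc_triangle hp hk)

theorem measurableSet_arcCore (hp : 2 < p) {n k : ℕ} (hk : k < 2 ^ n) :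
    MeasurableSet (arcCore p n k) := by
  have h := injective_planeMap (cross_arc_triangle_pos hp hk).ne'
  have h1 : MeasurableSet (Ioo (1 / 4 : ℝ) (3 / 8) ×ℂ Ioo (1 / 4 : ℝ) (3 / 8)) :=
    (measurableSet_Ioo.preimage Complex.measurable_re).inter
      (measurableSet_Ioo.preimage Complex.measurable_im)
  have h2 := h1.image_of_continuousOn_injOn (planeMap _ _).continuous.continuousOn h.injOn
  exact (measurableEmbedding_addLeft _).measurableSet_image.2 h2

theorem volume_arcCore (hp : 2 < p) {n k : ℕ} (hk : k < 2 ^ n) :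
    volume (arcCore p n k) = ENNReal.ofReal
      (cross (curve p (arcLeft p n k + 1 / p / p ^ n) - curve p (arcLeft p n k))
        (curve p (arcRight p n k) - curve p (arcLeft p n k)) / 64) := by
  have h := cross_arc_triangle_pos hp hk
  rw [arcCore, image_add_left, measure_preimage_add, volume_planeMap_image, volume_reProdIm,
    Real.volume_Ioo,
    abs_of_pos h, ← ENNReal.ofReal_mul (by norm_num), ← ENNReal.ofReal_mul h.le]
  congr 1
  ring

theorem cross_chord_neg_of_mem_arcCore (hp : 2 < p) {n k : ℕ} (hk : k < 2 ^ n) {z : ℂ}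
    (hz : z ∈ arcCore p n k) :
    cross (curve p (arcRight p n k) - curve p (arcLeft p n k)) (z - curve p (arcLeft p n k)) <
      0 := by
  obtain ⟨x, hx, x', hx', rfl⟩ := mem_arcCore hz
  have h := cross_arc_triangle_pos hp hk
  rw [add_assoc, add_sub_cancel_left, cross_add_right, cross_smul_right, cross_smul_right,
    cross_self, mul_zero, add_zero, cross_swap]
  have : 0 < x := by linarith [hx.1]
  nlinarith [mul_pos this h]

theorem arcRight_le_arcLeft (hp : 2 < p) {n k : ℕ} : ∀ j, k < j → j < 2 ^ n →
    arcRight p n k ≤ arcLeft p n j := by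
  have hp0 : 0 < p := by linarith
  refine Nat.le_induction (fun h => (arcRight_lt_arcLeft_succ hp n k h).le) fun j hj ih h => ?_
  have h1 := ih (by omega)
  have h2 := arcRight_lt_arcLeft_succ hp n j h
  have h3 : arcLeft p n j ≤ arcRight p n j := by
    rw [arcRight]; have : 0 < 1 / p ^ n := by positivity
    linarith
  linarith

/-- The points of the curve that are not on an arc lie on the inner side of its chord. -/
theorem cross_chord_nonneg_of_notMem (hp : 2 < p) {l r t : ℝ} (hl : l ∈ Icc (0 : ℝ) 1)
    (hr : r ∈ Icc (0 : ℝ) 1) (hlr : l ≤ r) (ht : t ∈ Icc (0 : ℝ) 1) (h : t ≤ l ∨ r ≤ t) :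
    0 ≤ cross (curve p r - curve p l) (curve p t - curve p l) := by
  rcases h with h | h
  · rw [← neg_sub (curve p l) (curve p t), cross_neg_right, ← cross_swap]
    exact cross_chord_chord_nonneg hp ht.1 h le_rfl hlr hr.2
  · have := cross_chord_chord_nonneg hp hl.1 hlr le_rfl h ht.2
    rwa [← sub_add_sub_cancel (curve p t) (curve p r), cross_add_right, cross_self, add_zero]

theorem disjoint_arcCore (hp : 2 < p) {n k j : ℕ} (hk : k < 2 ^ n) (hj : j < 2 ^ n)
    (hkj : k ≠ j) : Disjoint (arcCore p n k) (arcCore p n j) := by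
  have hp0 : 0 < p := by linarith
  have hpn : 0 < p ^ n := by positivity
  rw [Set.disjoint_left]
  intro z hz hz'
  have h1 := cross_chord_neg_of_mem_arcCore hp hk hz
  obtain ⟨x, hx, x', hx', rfl⟩ := mem_arcCore hz'
  have i1 : 1 / p ∈ Icc (0 : ℝ) 1 := ⟨by positivity, by rw [div_le_one hp0]; linarith⟩
  have hmid := (arcLeft_add_mem hp n j hj _ i1).1
  have o0 : ∀ i, arcLeft p n i ≤ arcRight p n i := fun i => by
    rw [arcRight]; have : 0 < 1 / p ^ n := by positivity
    linarith
  have o1 : arcLeft p n j ≤ arcLeft p n j + 1 / p / p ^ n := by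
    linarith [div_nonneg i1.1 hpn.le]
  have o2 : arcLeft p n j + 1 / p / p ^ n ≤ arcRight p n j := by
    rw [arcRight]; gcongr; exact i1.2
  have hside : ∀ t ∈ Icc (arcLeft p n j) (arcRight p n j),
      t ≤ arcLeft p n k ∨ arcRight p n k ≤ t := by
    intro t ht
    rcases lt_or_gt_of_ne hkj with h | h
    · right; exact (arcRight_le_arcLeft hp j h hj).trans ht.1
    · left; exact ht.2.trans (arcRight_le_arcLeft hp k h hk)
  have hl := arcLeft_mem hp hk
  have hr := arcRight_mem hp hk
  have c1 := cross_chord_nonneg_of_notMem hp hl hr (o0 k) (arcLeft_mem hp hj)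
    (hside _ ⟨le_rfl, o0 j⟩)
  have c2 := cross_chord_nonneg_of_notMem hp hl hr (o0 k) hmid (hside _ ⟨o1, o2⟩)
  have c3 := cross_chord_nonneg_of_notMem hp hl hr (o0 k) (arcRight_mem hp hj)
    (hside _ ⟨o0 j, le_rfl⟩)
  set a := curve p (arcLeft p n k)
  set w := curve p (arcRight p n k) - a
  set a' := curve p (arcLeft p n j)
  set b' := curve p (arcLeft p n j + 1 / p / p ^ n)
  set c' := curve p (arcRight p n j)
  have e : a' + x • (b' - a') + x' • (c' - a') - a =
      (1 - x - x') • (a' - a) + x • (b' - a) + x' • (c' - a) := by module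
  rw [e, cross_add_right, cross_add_right, cross_smul_right, cross_smul_right,
    cross_smul_right] at h1
  have := mul_nonneg (show 0 ≤ 1 - x - x' by linarith [hx.2, hx'.2]) c1
  have := mul_nonneg (show 0 ≤ x by linarith [hx.1]) c2
  have := mul_nonneg (show 0 ≤ x' by linarith [hx'.1]) c3
  linarith

theorem ball_subset_domain_of_mem_arcCore (hp : 2 < p) {n k : ℕ} (hk : k < 2 ^ n) {z : ℂ}
    (hz : z ∈ arcCore p n k) :
    Metric.ball z ((1 - 2 / p) / p ^ 2 / 16 / (2 * p) ^ n) ⊆ domain p := by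
  have hp0 : 0 < p := by linarith
  have hpn : 0 < 1 / p ^ n := by positivity
  have hc0 : 0 < 1 - 2 / p := by rw [sub_pos, div_lt_one hp0]; exact hp
  obtain ⟨x, hx, x', hx', rfl⟩ := mem_arcCore hz
  have i1 : 1 / p ∈ Icc (0 : ℝ) 1 := ⟨by positivity, by rw [div_le_one hp0]; linarith⟩
  have hl := arcLeft_mem hp hk
  have hr := arcRight_mem hp hk
  have hmid := (arcLeft_add_mem hp n k hk _ i1).1
  have n1 := norm_curve_sub_le hp hl hmid
  have n2 := norm_curve_sub_le hp hl hr
  rw [add_sub_cancel_left, abs_of_nonneg (by positivity)] at n1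
  rw [arcRight, add_sub_cancel_left, abs_of_nonneg (by positivity)] at n2
  refine interior_maximal (ball_subset_of_triangle (convex_convexHull ℝ _) (curve_mem_hull hl)
    (curve_mem_hull hmid) (curve_mem_hull hr) hpn (n1.trans ?_) n2 (by positivity) ?_ hx.1.le
    hx'.1.le (by linarith [hx.2, hx'.2])) Metric.isOpen_ball
  · exact div_le_div_of_nonneg_right i1.2 (by positivity)
  · refine le_trans (le_of_eq ?_) (pow_le_cross_arc_triangle hp hk)
    rw [mul_pow]
    field_simp
    ring

/-- In the core of a cap the density is at least a multiple of the inverse of the area of the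
cap. -/
theorem le_busemann_of_mem_arcCore (hp : 2 < p) {n k : ℕ} (hk : k < 2 ^ n) (hn : 2 ≤ n) {z : ℂ}
    (hz : z ∈ arcCore p n k) :
    ENNReal.ofReal (2 ^ n / (8 * (1 / p ^ n) ^ 2)) ≤ busemann (domain p) z := by
  have hp0 : 0 < p := by linarith
  have hpn : 0 < 1 / p ^ n := by positivity
  have hc0 : 0 < 1 - 2 / p := by rw [sub_pos, div_lt_one hp0]; exact hp
  have hzΩ : z ∈ domain p := ball_subset_domain_of_mem_arcCore hp hk hz
    (Metric.mem_ball_self (by positivity))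
  have hneg := cross_chord_neg_of_mem_arcCore hp hk hz
  -- Of two points that are symmetric about `z`, one is on the outer side of the chord.
  refine le_trans ?_ (le_busemann isOpen_domain convex_domain (isBounded_domain hp) hzΩ
    (H := (z + ·) ⁻¹' arcCap p n k) fun v h1 h2 => ?_)
  · rw [measure_preimage_add]
    have h := volume_arcCap_le hp hk hn
    calc ENNReal.ofReal (2 ^ n / (8 * (1 / p ^ n) ^ 2)) =
        ENNReal.ofReal Real.pi / (8 * ENNReal.ofReal (Real.pi / 2 ^ n * (1 / p ^ n) ^ 2)) := by
          rw [show (8 : ENNReal) = ENNReal.ofReal 8 by norm_num,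
            ← ENNReal.ofReal_mul (by norm_num), ← ENNReal.ofReal_div_of_pos (by positivity)]
          congr 1
          field_simp
      _ ≤ _ := by gcongr
  · have hsum : cross (curve p (arcRight p n k) - curve p (arcLeft p n k))
          (z + v - curve p (arcLeft p n k)) +
        cross (curve p (arcRight p n k) - curve p (arcLeft p n k))
          (z - v - curve p (arcLeft p n k)) =
        2 * cross (curve p (arcRight p n k) - curve p (arcLeft p n k))
          (z - curve p (arcLeft p n k)) := by
      simp only [cross, Complex.sub_re, Complex.sub_im, Complex.add_re, Complex.add_im]
      ring
    rcases le_total (cross (curve p (arcRight p n k) - curve p (arcLeft p n k))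
        (z + v - curve p (arcLeft p n k))) 0 with h | h
    · left; exact ⟨h1, h⟩
    · right
      rw [mem_preimage, ← sub_eq_add_neg]
      refine ⟨h2, ?_⟩
      linarith

/-- The lower bound: the cores of the `2 ^ n` caps of stage `n` are disjoint, have measure bounded
from below, and are not too close to the boundary. -/
theorem exists_le_hilbertMeasure (hp : 2 < p) :
    ∃ c : ℝ, 0 < c ∧ ∀ n : ℕ, 2 ≤ n → ∀ x ∈ domain p, ∀ t : ℝ, 0 < t → t ≤ c / (2 * p) ^ n →
      ENNReal.ofReal (c * 2 ^ n) ≤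
        hilbertMeasure (domain p) {y | y ∈ domain p ∧ y + t • (y - x) ∈ domain p} := by
  have hp0 : 0 < p := by linarith
  have hc0 : 0 < 1 - 2 / p := by rw [sub_pos, div_lt_one hp0]; exact hp
  obtain ⟨M, hM⟩ := Metric.isBounded_iff.1 (isBounded_domain hp)
  set c₀ := (1 - 2 / p) / p ^ 2 / 2 with hc₀
  have hc₀0 : 0 < c₀ := by positivity
  refine ⟨min (c₀ / 512) (c₀ / 8 / (|M| + 1)), by positivity, fun n hn x hx t ht0 ht => ?_⟩
  have hpn : 0 < 1 / p ^ n := by positivity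
  have hsub : ⋃ k ∈ Finset.range (2 ^ n), arcCore p n k ⊆
      {y | y ∈ domain p ∧ y + t • (y - x) ∈ domain p} := by
    intro y hy
    simp only [mem_iUnion, Finset.mem_range] at hy
    obtain ⟨k, hk, hy⟩ := hy
    have hball := ball_subset_domain_of_mem_arcCore hp hk hy
    have hyΩ := hball (Metric.mem_ball_self (by positivity))
    refine ⟨hyΩ, hball ?_⟩
    have h1 : ‖y - x‖ < |M| + 1 := by
      rw [← dist_eq_norm]; linarith [hM hyΩ hx, le_abs_self M]
    rw [Metric.mem_ball, dist_eq_norm, add_sub_cancel_left, norm_smul, Real.norm_of_nonneg ht0.le]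
    calc t * ‖y - x‖ < t * (|M| + 1) := mul_lt_mul_of_pos_left h1 ht0
      _ ≤ c₀ / 8 / (|M| + 1) / (2 * p) ^ n * (|M| + 1) := by
        apply mul_le_mul_of_nonneg_right _ (by positivity)
        refine ht.trans (div_le_div_of_nonneg_right (min_le_right _ _) (by positivity))
      _ = (1 - 2 / p) / p ^ 2 / 16 / (2 * p) ^ n := by
        rw [hc₀]; field_simp; ring
  refine le_trans ?_ (measure_mono hsub)
  rw [measure_biUnion_finset (fun i hi j hj hij => disjoint_arcCore hp (by simpa using hi)
    (by simpa using hj) hij) (fun k hk => measurableSet_arcCore hp (by simpa using hk))]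
  have hcore : ∀ k ∈ Finset.range (2 ^ n),
      ENNReal.ofReal (c₀ / 512) ≤ hilbertMeasure (domain p) (arcCore p n k) := by
    intro k hk
    have hk' : k < 2 ^ n := by simpa using hk
    have hΩ : arcCore p n k ⊆ domain p := fun z hz =>
      ball_subset_domain_of_mem_arcCore hp hk' hz (Metric.mem_ball_self (by positivity))
    rw [hilbertMeasure_apply hΩ]
    calc ENNReal.ofReal (c₀ / 512) ≤
        ENNReal.ofReal (2 ^ n / (8 * (1 / p ^ n) ^ 2)) * volume (arcCore p n k) := by
          rw [volume_arcCore hp hk', ← ENNReal.ofReal_mul (by positivity)]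
          apply ENNReal.ofReal_le_ofReal
          have h := pow_le_cross_arc_triangle hp hk'
          calc c₀ / 512 = 2 ^ n / (8 * (1 / p ^ n) ^ 2) *
              (c₀ * (1 / p ^ n) ^ 2 / 2 ^ n / 64) := by field_simp; norm_num
            _ ≤ _ := by gcongr
      _ = ∫⁻ _ in arcCore p n k, ENNReal.ofReal (2 ^ n / (8 * (1 / p ^ n) ^ 2)) := by
          rw [setLIntegral_const]
      _ ≤ _ := setLIntegral_mono' (measurableSet_arcCore hp hk') fun z hz =>
          le_busemann_of_mem_arcCore hp hk' hn hz
  refine le_trans ?_ (Finset.card_nsmul_le_sum _ _ _ hcore)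
  rw [Finset.card_range, nsmul_eq_mul, mul_comm, ENNReal.ofReal_mul (by positivity),
    ENNReal.ofReal_pow (by norm_num)]
  apply mul_le_mul' (le_of_eq (by simp)) (ENNReal.ofReal_le_ofReal (min_le_left _ _))

/-! ### The volume entropy -/

/-- A logarithmic error does not change the growth rate. -/
theorem tendsto_div_of_log_bounds {F : ℝ → ℝ} {h A B : ℝ}
    (hlow : ∀ᶠ R in atTop, h * R + A ≤ F R)
    (hupp : ∀ᶠ R in atTop, F R ≤ h * R + B + 2 * Real.log R) :
    Tendsto (fun R => F R / R) atTop (𝓝 h) := by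
  have hconst : ∀ c : ℝ, Tendsto (fun R : ℝ => c / R) atTop (𝓝 0) := fun c =>
    tendsto_const_nhds.div_atTop tendsto_id
  have hlog : Tendsto (fun R : ℝ => Real.log R / R) atTop (𝓝 0) :=
    Real.isLittleO_log_id_atTop.tendsto_div_nhds_zero
  have h1 : Tendsto (fun R : ℝ => h + A / R) atTop (𝓝 h) := by
    simpa using (hconst A).const_add h
  have h2 : Tendsto (fun R : ℝ => h + B / R + 2 * (Real.log R / R)) atTop (𝓝 h) := by
    simpa using ((hconst B).const_add h).add (hlog.const_mul 2)
  refine tendsto_of_tendsto_of_tendsto_of_le_of_le' h1 h2 ?_ ?_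
  · filter_upwards [hlow, eventually_gt_atTop 0] with R hR hR0
    have e : h + A / R = (h * R + A) / R := by field_simp
    rw [e]
    exact div_le_div_of_nonneg_right hR hR0.le
  · filter_upwards [hupp, eventually_gt_atTop 0] with R hR hR0
    have e : h + B / R + 2 * (Real.log R / R) = (h * R + B + 2 * Real.log R) / R := by field_simp
    rw [e]
    exact div_le_div_of_nonneg_right hR hR0.le

theorem eventually_hilbertMeasure_hilbertBall_le (hp : 2 < p) {x : ℂ} (hx : x ∈ domain p) :
    ∃ B : ℝ, ∀ᶠ R in atTop, hilbertMeasure (domain p) (hilbertBall (domain p) x R) ≤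
      ENNReal.ofReal (Real.exp
        (2 * Real.log 2 / Real.log (2 * p) * R + B + 2 * Real.log R)) := by
  obtain ⟨C, hC, n₀, hbound⟩ := exists_hilbertMeasure_shrunkDomain_le hp
  obtain ⟨c, hc, hc1, hball⟩ := exists_hilbertBall_subset_shrunkDomain hp hx
  set L := Real.log (2 * p) with hL
  have hL0 : 0 < L := Real.log_pos (by linarith)
  set K := Real.log (C / c) with hK
  refine ⟨(K / L + 1) * Real.log 2 + Real.log (16 * Real.pi * 9), ?_⟩
  filter_upwards [eventually_ge_atTop 1, eventually_ge_atTop ((n₀ * L - K) / 2),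
    eventually_ge_atTop (-K / 2), eventually_ge_atTop (2 - Real.log c)] with R hR1 hRn hRK hRc
  -- The stage is the first one whose caps are thinner than the depth of the ball.
  set n := ⌈(2 * R + K) / L⌉₊ with hn
  have hn1 : (2 * R + K) / L ≤ n := Nat.le_ceil _
  have hn2 : (n : ℝ) < (2 * R + K) / L + 1 :=
    Nat.ceil_lt_add_one (div_nonneg (by linarith) hL0.le)
  have hn0 : n₀ ≤ n := by
    have : (n₀ : ℝ) ≤ n := by
      refine le_trans ?_ hn1
      rw [le_div_iff₀ hL0]
      linarith
    exact_mod_cast this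
  have hη0 : 0 < c * Real.exp (-(2 * R)) := by positivity
  have hη1 : c * Real.exp (-(2 * R)) ≤ 1 :=
    mul_le_one₀ hc1 (Real.exp_nonneg _) (Real.exp_le_one_iff.2 (by linarith))
  have hpow : Real.exp (2 * R + K) ≤ (2 * p) ^ n := by
    rw [← Real.exp_log (show 0 < 2 * p by linarith), ← Real.exp_nat_mul, ← hL]
    exact Real.exp_le_exp.2 ((div_le_iff₀ hL0).1 hn1)
  have hη : C / (2 * p) ^ n ≤ c * Real.exp (-(2 * R)) := by
    rw [div_le_iff₀ (pow_pos (by linarith) n)]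
    calc C = c * Real.exp (-(2 * R)) * Real.exp (2 * R + K) := by
          rw [mul_assoc, ← Real.exp_add, neg_add_cancel_left, hK, Real.exp_log (by positivity)]
          field_simp
      _ ≤ _ := mul_le_mul_of_nonneg_left hpow hη0.le
  refine (measure_mono (hball R (by linarith))).trans ((hbound n hn0 _ hη0 hη1 hη).trans ?_)
  apply ENNReal.ofReal_le_ofReal
  have hlogη : Real.log (1 / (c * Real.exp (-(2 * R)))) + 2 ≤ 3 * R := by
    rw [one_div, Real.log_inv, Real.log_mul hc.ne' (Real.exp_ne_zero _), Real.log_exp]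
    linarith
  have hlogη0 : 0 ≤ Real.log (1 / (c * Real.exp (-(2 * R)))) :=
    Real.log_nonneg ((one_le_div hη0).2 hη1)
  have h2n : (2 : ℝ) ^ n ≤ Real.exp (((2 * R + K) / L + 1) * Real.log 2) := by
    rw [← Real.exp_log (show (0 : ℝ) < 2 by norm_num), ← Real.exp_nat_mul,
      Real.exp_log (show (0 : ℝ) < 2 by norm_num)]
    exact Real.exp_le_exp.2 (mul_le_mul_of_nonneg_right hn2.le (Real.log_nonneg (by norm_num)))
  have hfac : 16 * Real.pi * (Real.log (1 / (c * Real.exp (-(2 * R)))) + 2) ^ 2 ≤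
      Real.exp (Real.log (16 * Real.pi * 9) + 2 * Real.log R) := by
    rw [Real.exp_add, Real.exp_log (by positivity), two_mul (Real.log R), Real.exp_add,
      Real.exp_log (by linarith)]
    calc 16 * Real.pi * (Real.log (1 / (c * Real.exp (-(2 * R)))) + 2) ^ 2 ≤
        16 * Real.pi * (3 * R) ^ 2 := by gcongr
      _ = _ := by ring
  calc (2 : ℝ) ^ n * (16 * Real.pi * (Real.log (1 / (c * Real.exp (-(2 * R)))) + 2) ^ 2) ≤
      Real.exp (((2 * R + K) / L + 1) * Real.log 2) *
        Real.exp (Real.log (16 * Real.pi * 9) + 2 * Real.log R) :=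
        mul_le_mul h2n hfac (by positivity) (Real.exp_nonneg _)
    _ = _ := by
      rw [← Real.exp_add]
      congr 1
      ring

theorem eventually_le_hilbertMeasure_hilbertBall (hp : 2 < p) {x : ℂ} (hx : x ∈ domain p) :
    ∃ A : ℝ, ∀ᶠ R in atTop, ENNReal.ofReal (Real.exp
        (2 * Real.log 2 / Real.log (2 * p) * R + A)) ≤
      hilbertMeasure (domain p) (hilbertBall (domain p) x R) := by
  obtain ⟨c, hc, hbound⟩ := exists_le_hilbertMeasure hp
  obtain ⟨C, hC1, hball⟩ := exists_subset_hilbertBall isOpen_domain convex_domain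
    (isBounded_domain hp) hx
  set L := Real.log (2 * p) with hL
  have hL0 : 0 < L := Real.log_pos (by linarith)
  have hC : 0 < C := by linarith
  set K := Real.log (2 * C / c) with hK
  refine ⟨Real.log c - (K / L + 1) * Real.log 2, ?_⟩
  filter_upwards [eventually_ge_atTop ((2 * L + K) / 2),
    eventually_ge_atTop (Real.log (2 * C) / 2)] with R hRn hRC
  -- The stage is the last one whose caps are thicker than the distance of the ball to the boundary.
  have hge : 2 ≤ (2 * R - K) / L := by
    rw [le_div_iff₀ hL0]; linarith
  set n := ⌊(2 * R - K) / L⌋₊ with hn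
  have hn1 : (n : ℝ) ≤ (2 * R - K) / L := Nat.floor_le (by linarith)
  have hn2 : (2 * R - K) / L < n + 1 := Nat.lt_floor_add_one _
  have hn0 : 2 ≤ n := Nat.le_floor (by exact_mod_cast hge)
  have hpow : (2 * p) ^ n ≤ Real.exp (2 * R - K) := by
    rw [← Real.exp_log (show 0 < 2 * p by linarith), ← Real.exp_nat_mul, ← hL]
    exact Real.exp_le_exp.2 ((le_div_iff₀ hL0).1 hn1)
  have ht : 2 * C * Real.exp (-(2 * R)) ≤ c / (2 * p) ^ n := by
    rw [le_div_iff₀ (pow_pos (by linarith) n)]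
    calc 2 * C * Real.exp (-(2 * R)) * (2 * p) ^ n ≤
        2 * C * Real.exp (-(2 * R)) * Real.exp (2 * R - K) :=
          mul_le_mul_of_nonneg_left hpow (by positivity)
      _ = c := by
          rw [mul_assoc, ← Real.exp_add, neg_add_eq_sub, sub_sub_cancel_left, Real.exp_neg, hK,
            Real.exp_log (by positivity)]
          field_simp
  have ht1 : 2 * C * Real.exp (-(2 * R)) ≤ 1 := by
    rw [← Real.exp_log (show 0 < 2 * C by positivity), ← Real.exp_add]
    exact Real.exp_le_one_iff.2 (by linarith)
  have hsub := hball R (2 * C * Real.exp (-(2 * R)))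
    (by nlinarith [mul_pos hC (Real.exp_pos (-(2 * R)))]) ht1
  refine le_trans ?_ ((hbound n hn0 x hx _ (by positivity) ht).trans (measure_mono hsub))
  apply ENNReal.ofReal_le_ofReal
  have h2n : Real.exp (((2 * R - K) / L - 1) * Real.log 2) ≤ (2 : ℝ) ^ n := by
    rw [← Real.exp_log (show (0 : ℝ) < 2 by norm_num), ← Real.exp_nat_mul,
      Real.exp_log (show (0 : ℝ) < 2 by norm_num)]
    exact Real.exp_le_exp.2
      (mul_le_mul_of_nonneg_right (by linarith) (Real.log_nonneg (by norm_num)))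
  calc Real.exp (2 * Real.log 2 / L * R + (Real.log c - (K / L + 1) * Real.log 2)) =
      c * Real.exp (((2 * R - K) / L - 1) * Real.log 2) := by
        rw [← Real.exp_log hc, ← Real.exp_add, Real.exp_log hc]
        congr 1
        ring
    _ ≤ c * 2 ^ n := mul_le_mul_of_nonneg_left h2n hc.le

theorem hasVolumeEntropy_domain (hp : 2 < p) :
    HasVolumeEntropy (domain p) (2 * Real.log 2 / Real.log (2 * p)) := by
  intro x hx
  obtain ⟨A, hA⟩ := eventually_le_hilbertMeasure_hilbertBall hp hx
  obtain ⟨B, hB⟩ := eventually_hilbertMeasure_hilbertBall_le hp hx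
  have htop : ∀ᶠ R in atTop,
      hilbertMeasure (domain p) (hilbertBall (domain p) x R) ≠ ⊤ := by
    filter_upwards [hB] with R hR
    exact ne_top_of_le_ne_top ENNReal.ofReal_ne_top hR
  have hlow : ∀ᶠ R in atTop, Real.exp (2 * Real.log 2 / Real.log (2 * p) * R + A) ≤
      (hilbertMeasure (domain p) (hilbertBall (domain p) x R)).toReal := by
    filter_upwards [hA, htop] with R hR hR'
    exact (ENNReal.ofReal_le_iff_le_toReal hR').1 hR
  refine tendsto_div_of_log_bounds (A := A) (B := B) ?_ ?_
  · filter_upwards [hlow] with R hR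
    exact (Real.le_log_iff_exp_le (lt_of_lt_of_le (Real.exp_pos _) hR)).2 hR
  · filter_upwards [hlow, hB] with R hR hR'
    rw [Real.log_le_iff_le_exp (lt_of_lt_of_le (Real.exp_pos _) hR)]
    exact ENNReal.toReal_le_of_le_ofReal (Real.exp_nonneg _) hR'

end CantorLebesgue
end

/-- For `p > 2` the closed curve obtained from `γ(t) = ∫₀ᵗ e^{iπ f}` is the boundary of the
(nonempty, open, convex) Cantor-Lebesgue domain `Ω_p`, and the Hilbert geometry of `Ω_p` has volume
entropy `2α / (1 + α)` with `α = log 2 / log p`. -/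
theorem theorem4p1 (p α : ℝ) (hp : 2 < p) (hα : α = Real.log 2 / Real.log p) :
    (CantorLebesgue.domain p).Nonempty ∧
    frontier (CantorLebesgue.domain p) = CantorLebesgue.boundaryCurve p ∧
    HilbertGeometry.HasVolumeEntropy (CantorLebesgue.domain p) (2 * α / (1 + α)) := by
  refine ⟨CantorLebesgue.nonempty_domain hp, CantorLebesgue.frontier_domain hp, ?_⟩
  have hlog : 0 < Real.log p := Real.log_pos (by linarith)
  have hlog2 : 0 < Real.log 2 := Real.log_pos (by norm_num)
  have e : 2 * α / (1 + α) = 2 * Real.log 2 / Real.log (2 * p) := by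
    rw [hα, Real.log_mul two_ne_zero (by linarith)]
    field_simp
    ring
  rw [e]
  exact CantorLebesgue.hasVolumeEntropy_domain hp
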